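/- **Setting.** Let $d\ge1$, $D=\binom d2$, and index $x\in\mathbb R^D$ by pairs $(ij)$, $1\le i<j\le d$. Let $\mathcal A(x)\in\mathbb R^{d\times d}$ be the symmetric matrix with zero diagonal and upper triangular entries $x$, and let $\mathcal L(x)=\mathrm{diag}(\mathcal A(x)\mathbf 1)-\mathcal A(x)$. Write $|x|$ for the entrywise absolute value, $\lambda_{(j)}(M)$ for the $j$-th smallest eigenvalue of a symmetric matrix $M$, $\|\cdot\|_{op}$ and $\|\cdot\|_F$ for the operator ($2\to2$) and Frobenius norms, and $\|\cdot\|_{\max}$ for the largest absolute value of an entry. Let $\beta^*\in\mathbb R^D$ be a target and $\mathcal G^*$ the graph on $\{1,\dots,d\}$ whose edges are the nonzero entries of $\mathcal A(\beta^*)$. Let $K^*$ be its number of connected components (isolated nodes count), $d^*_{\max}$ the largest number of nodes of a component, $S^*$ the set of pairs $(ij)$ with $i,j$ in the same component, $S^{*C}$ its complement, and $\triangle^*=\lambda_{(K^*+1)}(\mathcal L(|\beta^*|))$ the target spectral gap (with $\triangle^*=+\infty$ if $K^*=d$, i.e. $\beta^*=0$). Let $a_0\ge a_1>0$, $b_2>b_1>0$,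 $\tau\ge0$, $\rho\ge0$, and let $g_\tau:[0,\infty)\to\mathbb R$ be increasing (not necessarily strictly) and concave with $g_\tau(0)=0$, differentiable on $(0,\infty)$, with $g_\tau'(0):=g_\tau'(0+)=a_0\tau$, $g_\tau'(t)\ge a_1\tau$ for $t\in(0,b_1\tau]$ and $g_\tau'(t)=0$ for $t\ge b_2\tau$. Let $\ell:\mathbb R^D\to\mathbb R$ be a random loss function and $\widehat\beta^{\rm initial}\in\mathbb R^D$ a random vector on a common probability space, such that almost surely $\ell$ is convex and differentiable. *LLA algorithm.* An LLA step from $\beta$ takes an orthogonal matrix $V$ of eigenvectors of $\mathcal L(|\beta|)$ with eigenvalues $\lambda_1,\dots,\lambda_d$, sets $M_{(ij)}=\sum_{k=1}^d g_\tau'(\lambda_k)(V_{ik}-V_{jk})^2$, and returns a minimizer over $x\in\mathbb R^D$ of $\ell(x)+\frac12\sum_{(ij)}M_{(ij)}|x_{(ij)}|$. *Oracles.* The block oracle $\widehat\beta^{\rm oracle}$ minimizes $\ell(\beta)$ subject to $\beta_{S^{*C}}=0$. For $w\in\mathbb R^D$ with nonnegative entries and $w_{S^{*C}}=0$, the Lasso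 oracle problem is $$\min_\beta\ \ell(\beta)+\tfrac12\sum_{(ij)\in S^*}w_{(ij)}|\beta_{(ij)}|\quad\text{subject to }\beta_{S^{*C}}=0 .$$ Let $\mathcal B^{op}_{\rho,\tau}$ be the set of minimizers of Lasso oracle problems over all such $w$ with $\|w\|_{\max}\le2^5a_0\tau\rho^2$, and $\mathcal B^{frob}_{\rho,\tau}$ the set of those for which moreover $\|w\|_2\le2^{9/2}(d^*_{\max})^{1/2}a_0\tau\rho^2$ and $\|w\|_1\le2^4d^*_{\max}a_0\tau\rho^2$. *Probabilities.* Let $$C=\min\Big(\rho,\ \tfrac1{2^6}\sqrt{\tfrac{a_1}{a_0d^*_{\max}}},\ \tfrac{b_1}{b_1+b_2}\Big)(b_1+b_2),\qquad r=|\widehat\beta^{\rm initial}|-|\beta^*|,$$ $$\delta^{\text{good init},op}=\mathbb P\big(\|\mathcal L(r)\|_{op}\ge C\tau\big),\qquad \delta^{\text{good init},frob}=\mathbb P\big(\min(\|\mathcal L(r)\|_F,\sqrt{K^*}\,\|\mathcal L(r)\|_{op})\ge C\tau\big),$$ and for $\bullet\in\{op,frob\}$ $$\delta^{\text{nice grad},\bullet}=\mathbb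 P\Big(\sup_{\beta\in\mathcal B^\bullet_{\rho,\tau}}\|\nabla_{S^{*C}}\ell(\beta)\|_{\max}>\tfrac{a_1\tau}{4d^*_{\max}}\Big),\qquad \delta^{\text{small lap resid},\bullet}=\mathbb P\Big(\sup_{\beta\in\mathcal B^\bullet_{\rho,\tau}}\|\mathcal L(|\beta|-|\beta^*|)\|_{op}\ge b_1\tau\Big).$$ **Statement.** Suppose that almost surely $\widehat\beta^{\rm oracle}$ is the unique solution of the block oracle problem and the Lasso oracle problem has a unique solution for every nonnegative weight vector $w$ with $w_{S^{*C}}=0$, and that $\triangle^*\ge(b_1+b_2)\tau$. Then, for each of $\bullet=op$ and $\bullet=frob$, with probability at least $$1-\delta^{\text{good init},\bullet}-\delta^{\text{nice grad},\bullet}-\delta^{\text{small lap resid},\bullet}$$ the LLA algorithm started at $\widehat\beta^{\rm initial}$ converges to $\widehat\beta^{\rm oracle}$ in two steps: the first two LLA steps can be carried out, the result of the second one is $\widehat\beta^{\rm oracle}$ whatever eigenvectors and minimizers are chosen on the way, and $\widehat\beta^{\rm oracle}$ is the only result of a further LLA step from $\widehat\beta^{\rm oracle}$. -/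

import Mathlib

open MeasureTheory Set Filter Topology

/-! ### Graphs, adjacency matrices and Laplacians -/

/-- The `d choose 2` edge slots on the nodes `Fin d`: the pairs `(i, j)` with `i < j`. -/
abbrev Edge (d : ℕ) : Type := {p : Fin d × Fin d // p.1 < p.2}

/-- The parameter space `ℝ^D`, `D = d choose 2`, with its Euclidean structure. -/
abbrev ParamSpace (d : ℕ) : Type := EuclideanSpace ℝ (Edge d)

/-- The hollow symmetric matrix whose upper triangular entries are given by `x`. -/
def adjMat {d : ℕ} (x : ParamSpace d) : Matrix (Fin d) (Fin d) ℝ :=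
  Matrix.of fun i j =>
    if h : i < j then x ⟨(i, j), h⟩ else if h : j < i then x ⟨(j, i), h⟩ else 0

/-- The Laplacian matrix `diag(A 1) - A`. -/
def laplacian {d : ℕ} (A : Matrix (Fin d) (Fin d) ℝ) : Matrix (Fin d) (Fin d) ℝ :=
  Matrix.diagonal (fun i => ∑ j, A i j) - A

/-- The Laplacian of the weighted graph with edge weights `x`. -/
def lap {d : ℕ} (x : ParamSpace d) : Matrix (Fin d) (Fin d) ℝ := laplacian (adjMat x)

/-- Entrywise absolute value. -/
noncomputable def absVec {d : ℕ} (x : ParamSpace d) : ParamSpace d :=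
  WithLp.toLp 2 fun e => |x e|

theorem adjMat_symm {d : ℕ} (x : ParamSpace d) (i j : Fin d) : adjMat x i j = adjMat x j i := by
  rcases lt_trichotomy i j with h | h | h
  · simp [adjMat, h, h.not_gt]
  · rw [h]
  · simp [adjMat, h, h.not_gt]

theorem adjMat_diag {d : ℕ} (x : ParamSpace d) (i : Fin d) : adjMat x i i = 0 := by
  simp [adjMat]

theorem lap_isHermitian {d : ℕ} (x : ParamSpace d) : (lap x).IsHermitian := by
  ext i j
  by_cases h : i = j
  · subst h; simp
  · simp [lap, laplacian, Matrix.diagonal_apply_ne _ h, Matrix.diagonal_apply_ne' _ h,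
      adjMat_symm x i j]

/-- The eigenvalues of the Laplacian of `x`, with multiplicity, in increasing order:
`lapEig x k` is the `(k + 1)`-st smallest one.  (`eigenvalues₀` lists them in decreasing order.) -/
noncomputable def lapEig {d : ℕ} (x : ParamSpace d) (k : Fin d) : ℝ :=
  (lap_isHermitian x).eigenvalues₀ (Fin.cast (Fintype.card_fin d).symm (Fin.rev k))

/-- The operator norm of a square matrix for the Euclidean norm. -/
noncomputable def opNorm {d : ℕ} (A : Matrix (Fin d) (Fin d) ℝ) : ℝ :=
  ‖Matrix.toEuclideanCLM (𝕜 := ℝ) A‖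

/-- The Frobenius norm. -/
noncomputable def frobNorm {d : ℕ} (A : Matrix (Fin d) (Fin d) ℝ) : ℝ :=
  Real.sqrt (∑ i, ∑ j, A i j ^ 2)

/-- The binary graph of the non-zero entries of the adjacency matrix. -/
def supportGraph {d : ℕ} (x : ParamSpace d) : SimpleGraph (Fin d) where
  Adj i j := adjMat x i j ≠ 0
  symm := ⟨fun i j h => by rwa [adjMat_symm x j i]⟩
  loopless := ⟨fun i h => h (adjMat_diag x i)⟩

open Classical in
/-- The block support: the edge slots whose two ends lie in the same connected component. -/
noncomputable def blockSupport {d : ℕ} (x : ParamSpace d) : Finset (Edge d) :=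
  Finset.univ.filter fun e => (supportGraph x).Reachable e.1.1 e.1.2

/-- The number of connected components (isolated nodes count). -/
noncomputable def numComp {d : ℕ} (x : ParamSpace d) : ℕ :=
  Nat.card (supportGraph x).ConnectedComponent

/-- The number of nodes of the largest connected component. -/
noncomputable def maxCompSize {d : ℕ} (x : ParamSpace d) : ℕ :=
  ⨆ c : (supportGraph x).ConnectedComponent, c.supp.ncard

/-- The spectral gap: the `(K + 1)`-st smallest eigenvalue of the Laplacian of `|x|`, where `K` is
the number of connected components.  It is `⊤` if there is no such eigenvalue, that is if `x = 0`
(the minimum over the non-zero blocks is then a minimum over the empty set). -/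
noncomputable def spectralGap {d : ℕ} (x : ParamSpace d) : EReal :=
  if h : numComp x < d then ((lapEig (absVec x) ⟨numComp x, h⟩ : ℝ) : EReal) else ⊤

/-! ### SCAD-like penalties and the local linear approximation algorithm -/

/-- The derivative of the penalty on `[0, ∞)`, with the convention `g'(0) := g'(0+)`. -/
noncomputable def penaltyDeriv (g : ℝ → ℝ) (t : ℝ) : ℝ :=
  if 0 < t then deriv g t else limUnder (𝓝[>] (0 : ℝ)) (deriv g)

/-- SCAD-like concave penalty functions with tuning parameter `τ` (only the values of `g` on
`[0, ∞)` matter). -/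
structure IsScadLike (a₀ a₁ b₁ b₂ τ : ℝ) (g : ℝ → ℝ) : Prop where
  a₁_pos : 0 < a₁
  a₁_le_a₀ : a₁ ≤ a₀
  b₁_pos : 0 < b₁
  b₁_lt_b₂ : b₁ < b₂
  monotoneOn : MonotoneOn g (Ici 0)
  concaveOn : ConcaveOn ℝ (Ici 0) g
  map_zero : g 0 = 0
  differentiableAt : ∀ t, 0 < t → DifferentiableAt ℝ g t
  tendsto_deriv : Tendsto (deriv g) (𝓝[>] (0 : ℝ)) (𝓝 (a₀ * τ))
  le_deriv : ∀ t, 0 < t → t ≤ b₁ * τ → a₁ * τ ≤ penaltyDeriv g t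
  deriv_eq_zero : ∀ t, b₂ * τ ≤ t → penaltyDeriv g t = 0

/-- The Laplacian coefficient: `M(V, w)_(ij) = ∑ k, w k * (V i k - V j k) ^ 2`. -/
def lapCoeff {d : ℕ} (V : Matrix (Fin d) (Fin d) ℝ) (w : Fin d → ℝ) (e : Edge d) : ℝ :=
  ∑ k, w k * (V e.1.1 k - V e.1.2 k) ^ 2

/-- `β'` is a result of one LLA step from `β`: for some orthonormal eigenvectors (the columns
of `V`) and corresponding eigenvalues of the Laplacian of `|β|`, it minimizes the loss plus the
Lasso penalty weighted by the Laplacian coefficient. -/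
def IsLLAStep {d : ℕ} (loss : ParamSpace d → ℝ) (g : ℝ → ℝ) (β β' : ParamSpace d) : Prop :=
  ∃ V ∈ Matrix.orthogonalGroup (Fin d) ℝ, ∃ ev : Fin d → ℝ,
    lap (absVec β) * V = V * Matrix.diagonal ev ∧
    IsMinOn (fun x : ParamSpace d =>
      loss x + 1 / 2 * ∑ e, |x e| * lapCoeff V (fun k => penaltyDeriv g (ev k)) e) univ β'

/-- The LLA algorithm started at `β₀` converges to `b` in two steps: the first two steps can be
carried out, their result is `b` whatever minimizers and eigenvectors are chosen on the way, and
`b` is a fixed point, the only possible result of an LLA step from `b`. -/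
def LLAConvergesInTwoSteps {d : ℕ} (loss : ParamSpace d → ℝ) (g : ℝ → ℝ)
    (β₀ b : ParamSpace d) : Prop :=
  (∃ β₁, IsLLAStep loss g β₀ β₁) ∧
  (∀ β₁, IsLLAStep loss g β₀ β₁ →
    (∃ β₂, IsLLAStep loss g β₁ β₂) ∧ ∀ β₂, IsLLAStep loss g β₁ β₂ → β₂ = b) ∧
  ∀ β, IsLLAStep loss g b β ↔ β = b

/-! ### Oracle problems -/

/-- The vectors that vanish outside `S`. -/
def supportedOn {d : ℕ} (S : Finset (Edge d)) : Set (ParamSpace d) :=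
  {β | ∀ e, e ∉ S → β e = 0}

/-- `β` is a solution of the block oracle problem: minimize the loss subject to `β = 0`
outside `S`. -/
def IsBlockOracle {d : ℕ} (loss : ParamSpace d → ℝ) (S : Finset (Edge d))
    (β : ParamSpace d) : Prop :=
  β ∈ supportedOn S ∧ IsMinOn loss (supportedOn S) β

/-- `β` is a solution of the Lasso block oracle problem with weights `w`. -/
def IsLassoOracle {d : ℕ} (loss : ParamSpace d → ℝ) (S : Finset (Edge d)) (w : Edge d → ℝ)
    (β : ParamSpace d) : Prop :=
  β ∈ supportedOn S ∧
  IsMinOn (fun x : ParamSpace d => loss x + 1 / 2 * ∑ e ∈ S, w e * |x e|) (supportedOn S) β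

/-- Admissible weight vectors: non-negative, and zero outside `S`. -/
def IsLassoWeight {d : ℕ} (S : Finset (Edge d)) (w : Edge d → ℝ) : Prop :=
  (∀ e, 0 ≤ w e) ∧ ∀ e, e ∉ S → w e = 0

/-- Lasso block oracle solutions with small weights, operator norm version.  (The norm of a
function `Edge d → ℝ` is the maximum of the absolute values.) -/
def lassoOracleSetOp {d : ℕ} (loss : ParamSpace d → ℝ) (βstar : ParamSpace d)
    (a₀ ρ τ : ℝ) : Set (ParamSpace d) :=
  {β | ∃ w : Edge d → ℝ, IsLassoWeight (blockSupport βstar) w ∧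
    ‖w‖ ≤ 2 ^ 5 * a₀ * τ * ρ ^ 2 ∧
    IsLassoOracle loss (blockSupport βstar) w β}

/-- Lasso block oracle solutions with small weights, Frobenius norm version. -/
def lassoOracleSetFrob {d : ℕ} (loss : ParamSpace d → ℝ) (βstar : ParamSpace d)
    (a₀ ρ τ : ℝ) : Set (ParamSpace d) :=
  {β | ∃ w : Edge d → ℝ, IsLassoWeight (blockSupport βstar) w ∧
    ‖w‖ ≤ 2 ^ 5 * a₀ * τ * ρ ^ 2 ∧
    Real.sqrt (∑ e, w e ^ 2)
      ≤ (2 : ℝ) ^ (9 / 2 : ℝ) * Real.sqrt (maxCompSize βstar) * a₀ * τ * ρ ^ 2 ∧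
    ∑ e, |w e| ≤ 2 ^ 4 * maxCompSize βstar * a₀ * τ * ρ ^ 2 ∧
    IsLassoOracle loss (blockSupport βstar) w β}

/-! ### The probabilities -/

/-- The constant in the condition on the initializer. -/
noncomputable def initConst {d : ℕ} (βstar : ParamSpace d) (a₀ a₁ b₁ b₂ ρ : ℝ) : ℝ :=
  min (min ρ (1 / 2 ^ 6 * Real.sqrt (a₁ / (a₀ * maxCompSize βstar)))) (b₁ / (b₁ + b₂)) * (b₁ + b₂)

/-- The size of a residual in the operator norm version: `‖L(r)‖_op`. -/
noncomputable def residOp {d : ℕ} (r : ParamSpace d) : ℝ := opNorm (lap r)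

/-- The size of a residual in the Frobenius version: `min (‖L(r)‖_F) (K^{1/2} ‖L(r)‖_op)` where
`K` is the number of connected components of the target. -/
noncomputable def residFrob {d : ℕ} (βstar r : ParamSpace d) : ℝ :=
  min (frobNorm (lap r)) (Real.sqrt (numComp βstar) * opNorm (lap r))

/-- The probability that `resid (|β_init| - |β*|) ≥ C τ`. -/
noncomputable def probGoodInit {Ω : Type*} [MeasurableSpace Ω] (μ : Measure Ω) {d : ℕ}
    (resid : ParamSpace d → ℝ) (βinit : Ω → ParamSpace d) (βstar : ParamSpace d)
    (a₀ a₁ b₁ b₂ ρ τ : ℝ) : ℝ :=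
  μ.real {ω | initConst βstar a₀ a₁ b₁ b₂ ρ * τ ≤ resid (absVec (βinit ω) - absVec βstar)}

/-- The probability that the supremum over the random set `B` of the maximum norm of the
between-block part of the gradient exceeds `a₁ τ / (4 d_max)`.  The supremum is taken in
`[0, ∞]`. -/
noncomputable def probNiceGrad {Ω : Type*} [MeasurableSpace Ω] (μ : Measure Ω) {d : ℕ}
    (loss : Ω → ParamSpace d → ℝ) (B : Ω → Set (ParamSpace d)) (βstar : ParamSpace d)
    (a₁ τ : ℝ) : ℝ :=
  μ.real {ω | ENNReal.ofReal (a₁ * τ / (4 * maxCompSize βstar)) <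
    ⨆ β ∈ B ω, ⨆ (e : Edge d) (_ : e ∉ blockSupport βstar),
      ENNReal.ofReal |gradient (loss ω) β e|}

/-- The probability that the supremum over the random set `B` of `‖L(|β| - |β*|)‖_op` is at least
`b₁ τ`.  The supremum is taken in `[0, ∞]`. -/
noncomputable def probSmallLapResid {Ω : Type*} [MeasurableSpace Ω] (μ : Measure Ω) {d : ℕ}
    (B : Ω → Set (ParamSpace d)) (βstar : ParamSpace d) (b₁ τ : ℝ) : ℝ :=
  μ.real {ω | ENNReal.ofReal (b₁ * τ) ≤
    ⨆ β ∈ B ω, ENNReal.ofReal (opNorm (lap (absVec β - absVec βstar)))}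

/-- `A` holds with probability at least `p`: it contains a measurable event of probability at
least `p` (for measurable `A` this says that the probability of `A` is at least `p`). -/
def HoldsWithProbAtLeast {Ω : Type*} [MeasurableSpace Ω] (μ : Measure Ω) (p : ℝ)
    (A : Set Ω) : Prop :=
  ∃ E, MeasurableSet E ∧ E ⊆ A ∧ p ≤ μ.real E

/-!
The Laplacian `L* = L(|β*|)` vanishes on the space `N` of vectors that are constant on the blocks
(the components of the target graph), and the spectral gap says that it is at least
`Δ = (b₁ + b₂) τ` on the orthogonal complement of `N` (`gap_of_le_spectralGap`).  The Laplacian of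
`|β|`, for `β` close to the target, is a perturbation `L* + E` with `‖E‖ < b₁ τ`
(`IsGapPerturbation`).  Splitting the eigenvalue equation into its components in `N` and in the
complement shows that each eigenvalue is at most `‖E‖ < b₁ τ` in absolute value or at least
`Δ - ‖E‖ > b₂ τ`.  The penalty has slope between `a₁ τ` and `a₀ τ` at the former and slope `0` at
the latter, so the weight of an edge `(i, j)` in a step of the algorithm is comparable to the
squared norm of the projection of `e_i - e_j` on the span of the eigenvectors of small eigenvalues
(`exists_eigenbasis`).

This span is close to `N`, with angle of order `‖E‖ / Δ`, by Davis–Kahan type bounds that use no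
matching of eigenvectors.  If `i` and `j` are in the same block, `e_i - e_j` is orthogonal to `N`
and the weight is small.  Otherwise the component of `e_i - e_j` in `N` has squared norm at least
`2 / d_max` (`two_div_maxCompSize_le`) and the weight is larger than `a₁ τ / (2 d_max)`.  The sum of
the weights inside the blocks is controlled by `∑ ‖E v_k‖²` over the small eigenvalues, which is at
most `‖E‖_F²`, and at most `K ‖E‖²` because there are at most `K = dim N` small eigenvalues
(`lapCoeff_of_close`).

A Lasso oracle satisfies a variational inequality on vectors supported on the blocks.  If the
gradient of the loss between the blocks is smaller than half the weights there, convexity makes the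
oracle the unique minimizer of the whole penalized problem (`isMinOn_penalized_iff`).  So the first
step returns a Lasso oracle with small weights.  The Laplacian of this oracle vanishes on `N`, hence
the eigenvectors of its small eigenvalues lie in `N` exactly, and in the second step the weights
inside the blocks are zero (`lapCoeff_of_mem_supportedOn`): the second step returns the block
oracle.  The block oracle is itself the Lasso oracle with zero weights, so the same argument shows
that it is the only result of a step from it (`isLLAStep_iff_eq_oracle`).  The probability
statement is a union bound over the three bad events.
-/

open scoped InnerProductSpace

/-! ### Perturbation of an operator with a spectral gap above its kernel -/

section Perturbation

variable {F : Type*} [NormedAddCommGroup F] [InnerProductSpace ℝ F] [FiniteDimensional ℝ F]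
  {ι : Type*} [Fintype ι]

/-- A symmetric operator that vanishes on `N` has a spectral gap `Δ` on `Nᗮ` as soon as it has
at most `dim N` eigenvalues (with multiplicity) that are not at least `Δ`. -/
theorem gap_of_card_eigenvalues_le {L : F →L[ℝ] F} (hL : IsSelfAdjoint L) {N : Submodule ℝ F}
    (hN : ∀ u ∈ N, L u = 0) (b : OrthonormalBasis ι ℝ F) {ev : ι → ℝ}
    (hb : ∀ k, L (b k) = ev k • b k) {Δ : ℝ} (hΔ : 0 < Δ) {T : Finset ι}
    (hT : ∀ k, k ∉ T → Δ ≤ ev k) (hcard : T.card ≤ Module.finrank ℝ N) {v : F} (hv : v ∈ Nᗮ) :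
    Δ * ‖v‖ ^ 2 ≤ ⟪L v, v⟫_ℝ := by
  classical
  have hsym : ∀ x y, ⟪L x, y⟫_ℝ = ⟪x, L y⟫_ℝ :=
    ContinuousLinearMap.isSelfAdjoint_iff_isSymmetric.1 hL
  -- `N` is orthogonal to the eigenvectors outside `T`, hence equal to the span of those in `T`.
  have hle : N ≤ Submodule.span ℝ (b '' (T : Set ι)) := by
    intro u hu
    rw [← b.sum_repr u]
    refine Submodule.sum_mem _ fun k _ => ?_
    by_cases hk : k ∈ T
    · exact Submodule.smul_mem _ _ (Submodule.subset_span ⟨k, hk, rfl⟩)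
    · have h1 : ev k * ⟪b k, u⟫_ℝ = 0 := by
        rw [← real_inner_smul_left, ← hb, hsym, hN u hu, inner_zero_right]
      have h2 : ⟪b k, u⟫_ℝ = 0 :=
        (mul_eq_zero.1 h1).resolve_left (hΔ.trans_le (hT k hk)).ne'
      rw [b.repr_apply_apply, h2, zero_smul]
      exact Submodule.zero_mem _
  have heq : N = Submodule.span ℝ (b '' (T : Set ι)) := by
    refine Submodule.eq_of_le_of_finrank_le hle (le_trans ?_ hcard)
    rw [← Finset.coe_image]
    exact (finrank_span_finset_le_card _).trans Finset.card_image_le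
  have hzero : ∀ k ∈ T, ⟪b k, v⟫_ℝ = 0 := fun k hk => by
    refine (Submodule.mem_orthogonal _ _).1 hv _ ?_
    rw [heq]
    exact Submodule.subset_span ⟨k, hk, rfl⟩
  rw [← b.sum_sq_inner_right v, ← b.sum_inner_mul_inner (L v) v, Finset.mul_sum]
  refine Finset.sum_le_sum fun k _ => ?_
  rw [hsym, hb, real_inner_smul_right, real_inner_comm v (b k), real_inner_comm]
  by_cases hk : k ∈ T
  · rw [hzero k hk]
    simp
  · nlinarith [hT k hk, sq_nonneg ⟪b k, v⟫_ℝ]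

/-- `L'` is a symmetric perturbation, of norm at most `ε`, of the symmetric operator `L`, which
vanishes on `N` and is at least `Δ` on `Nᗮ`. -/
structure IsGapPerturbation (L L' : F →L[ℝ] F) (N : Submodule ℝ F) (Δ ε : ℝ) : Prop where
  symm : IsSelfAdjoint L
  symm' : IsSelfAdjoint L'
  map_zero : ∀ u ∈ N, L u = 0
  gap : ∀ v ∈ Nᗮ, Δ * ‖v‖ ^ 2 ≤ ⟪L v, v⟫_ℝ
  norm_sub_le : ∀ v, ‖L' v - L v‖ ≤ ε * ‖v‖
  nonneg : 0 ≤ ε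
  two_mul_lt : 2 * ε < Δ

namespace IsGapPerturbation

variable {L L' : F →L[ℝ] F} {N : Submodule ℝ F} {Δ ε : ℝ}

theorem inner_symm (h : IsGapPerturbation L L' N Δ ε) (x y : F) : ⟪L x, y⟫_ℝ = ⟪x, L y⟫_ℝ :=
  ContinuousLinearMap.isSelfAdjoint_iff_isSymmetric.1 h.symm x y

theorem inner_symm' (h : IsGapPerturbation L L' N Δ ε) (x y : F) : ⟪L' x, y⟫_ℝ = ⟪x, L' y⟫_ℝ :=
  ContinuousLinearMap.isSelfAdjoint_iff_isSymmetric.1 h.symm' x y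

theorem map_starProjection (h : IsGapPerturbation L L' N Δ ε) (v : F) :
    L (Nᗮ.starProjection v) = L v := by
  conv_rhs => rw [← N.starProjection_add_starProjection_orthogonal v, map_add,
    h.map_zero _ (N.starProjection_apply_mem v), zero_add]

theorem map_mem_orthogonal (h : IsGapPerturbation L L' N Δ ε) (v : F) : L v ∈ Nᗮ := by
  refine (Submodule.mem_orthogonal' _ _).2 fun u hu => ?_
  rw [h.inner_symm, h.map_zero u hu, inner_zero_right]

/-- The component in `Nᗮ` of the eigenvalue equation, tested against the component in `Nᗮ` of
the eigenvector. -/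
theorem gap_sub_mul_norm_le (h : IsGapPerturbation L L' N Δ ε) {v : F} {l : ℝ}
    (hv : L' v = l • v) :
    (Δ - l) * ‖Nᗮ.starProjection v‖ ≤ ‖Nᗮ.starProjection (L' v - L v)‖ := by
  set q := Nᗮ.starProjection v with hq
  have hqm : q ∈ Nᗮ := Nᗮ.starProjection_apply_mem v
  have h1 := h.gap q hqm
  have h2 : ⟪L q, q⟫_ℝ = l * ‖q‖ ^ 2 - ⟪Nᗮ.starProjection (L' v - L v), q⟫_ℝ := by
    have h3 : ⟪v, q⟫_ℝ = ‖q‖ ^ 2 := by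
      rw [← Submodule.starProjection_eq_self_iff.2 hqm,
        ← Submodule.inner_starProjection_left_eq_right, ← hq, real_inner_self_eq_norm_sq,
        Submodule.starProjection_eq_self_iff.2 hqm]
    rw [Submodule.inner_starProjection_left_eq_right, Submodule.starProjection_eq_self_iff.2 hqm,
      inner_sub_left, hv, real_inner_smul_left, h3, hq, h.map_starProjection]
    ring
  have h3 := neg_le_of_abs_le (abs_real_inner_le_norm (Nᗮ.starProjection (L' v - L v)) q)
  rcases (norm_nonneg q).eq_or_lt with h0 | h0
  · rw [← h0, mul_zero]; positivity
  · refine le_of_mul_le_mul_right ?_ h0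
    nlinarith

/-- The component in `N` of the eigenvalue equation. -/
theorem abs_mul_norm_starProjection (h : IsGapPerturbation L L' N Δ ε) {v : F} {l : ℝ}
    (hv : L' v = l • v) :
    |l| * ‖N.starProjection v‖ = ‖N.starProjection (L' v - L v)‖ := by
  rw [map_sub, (N.starProjection_apply_eq_zero_iff).2 (h.map_mem_orthogonal v), sub_zero, hv,
    map_smul, norm_smul, Real.norm_eq_abs]

/-- The eigenvalues of the perturbed operator are close to zero or close to the upper part of
the spectrum. -/
theorem abs_le_or_le (h : IsGapPerturbation L L' N Δ ε) {v : F} {l : ℝ} (h1 : ‖v‖ = 1)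
    (hv : L' v = l • v) : |l| ≤ ε ∨ Δ - ε ≤ l := by
  by_contra! hcon
  obtain ⟨ha, hb⟩ := hcon
  have hp := h.abs_mul_norm_starProjection hv
  have hq := h.gap_sub_mul_norm_le hv
  have hpy := N.norm_sq_eq_add_norm_sq_starProjection v
  have hpy' := N.norm_sq_eq_add_norm_sq_starProjection (L' v - L v)
  have hE := h.norm_sub_le v
  rw [h1, mul_one] at hE
  rw [h1] at hpy
  have hE2 : ‖L' v - L v‖ ^ 2 ≤ ε ^ 2 := by gcongr
  have hε := h.nonneg
  have e1 : (|l| * ‖N.starProjection v‖) ^ 2 = ‖N.starProjection (L' v - L v)‖ ^ 2 := by rw [hp]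
  have e2 : ((Δ - l) * ‖Nᗮ.starProjection v‖) ^ 2 ≤ ‖Nᗮ.starProjection (L' v - L v)‖ ^ 2 := by
    have : 0 ≤ Δ - l := by linarith
    gcongr
  have f1 : ε ^ 2 < |l| ^ 2 := by gcongr
  have f2 : ε ^ 2 < (Δ - l) ^ 2 := by
    have : ε < Δ - l := by linarith
    gcongr
  rw [mul_pow] at e1 e2
  have hP := sq_nonneg ‖N.starProjection v‖
  have hQ := sq_nonneg ‖Nᗮ.starProjection v‖
  rcases hP.eq_or_lt with h0 | h0
  · nlinarith
  · nlinarith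

/-- Davis–Kahan bound for a single eigenvector of a small eigenvalue. -/
theorem norm_orthogonal_le (h : IsGapPerturbation L L' N Δ ε) {v : F} {l : ℝ}
    (hv : L' v = l • v) (hl : |l| ≤ ε) :
    (Δ - ε) * ‖Nᗮ.starProjection v‖ ≤ ‖L' v - L v‖ := by
  refine le_trans ?_ (Nᗮ.norm_starProjection_apply_le _)
  refine le_trans ?_ (h.gap_sub_mul_norm_le hv)
  have := le_of_abs_le hl
  gcongr

variable (b : OrthonormalBasis ι ℝ F) {ev : ι → ℝ} (T : Finset ι)

/-- The span of the eigenvectors of small eigenvalues makes a small angle with `N`: the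
Davis–Kahan bound in operator norm. -/
theorem gap_mul_norm_orthogonal_le (h : IsGapPerturbation L L' N Δ ε)
    (hb : ∀ k, L' (b k) = ev k • b k) (hT : ∀ k ∈ T, |ev k| ≤ ε) (c : ι → ℝ) :
    Δ * ‖Nᗮ.starProjection (∑ k ∈ T, c k • b k)‖ ≤ 2 * ε * ‖∑ k ∈ T, c k • b k‖ := by
  classical
  set y := ∑ k ∈ T, c k • b k with hy
  have hnorm : ∀ a : ι → ℝ, ‖∑ k ∈ T, a k • b k‖ ^ 2 = ∑ k ∈ T, a k ^ 2 := fun a => by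
    rw [← real_inner_self_eq_norm_sq, b.orthonormal.inner_sum]
    simp [sq]
  have hL' : ‖L' y‖ ≤ ε * ‖y‖ := by
    refine le_of_sq_le_sq ?_ (mul_nonneg h.nonneg (norm_nonneg _))
    have : L' y = ∑ k ∈ T, (c k * ev k) • b k := by
      simp [hy, map_sum, hb, smul_smul]
    rw [this, hnorm, mul_pow, hy, hnorm, Finset.mul_sum]
    refine Finset.sum_le_sum fun k hk => ?_
    have : ev k ^ 2 ≤ ε ^ 2 := sq_le_sq' (abs_le.1 (hT k hk)).1 (abs_le.1 (hT k hk)).2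
    nlinarith [sq_nonneg (c k)]
  have hLy : ‖L y‖ ≤ 2 * ε * ‖y‖ := by
    calc ‖L y‖ = ‖L' y - (L' y - L y)‖ := by rw [sub_sub_cancel]
      _ ≤ ‖L' y‖ + ‖L' y - L y‖ := _root_.norm_sub_le _ _
      _ ≤ 2 * ε * ‖y‖ := by linarith [h.norm_sub_le y]
  have h1 := h.gap _ (Nᗮ.starProjection_apply_mem y)
  rw [h.map_starProjection] at h1
  have h2 := real_inner_le_norm (L y) (Nᗮ.starProjection y)
  rcases (norm_nonneg (Nᗮ.starProjection y)).eq_or_lt with h0 | h0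
  · rw [← h0, mul_zero]; exact (norm_nonneg _).trans hLy
  · refine le_of_mul_le_mul_right ?_ h0
    nlinarith

/-- The operator norm bound in its dual form: the projection of a vector of `Nᗮ` on the span of the
eigenvectors of small eigenvalues is small. -/
theorem sum_sq_inner_orthogonal_le (h : IsGapPerturbation L L' N Δ ε)
    (hb : ∀ k, L' (b k) = ev k • b k) (hT : ∀ k ∈ T, |ev k| ≤ ε) {x : F} (hx : x ∈ Nᗮ) :
    Δ ^ 2 * ∑ k ∈ T, ⟪b k, x⟫_ℝ ^ 2 ≤ (2 * ε) ^ 2 * ‖x‖ ^ 2 := by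
  classical
  set s := ∑ k ∈ T, ⟪b k, x⟫_ℝ ^ 2 with hs
  have hs0 : 0 ≤ s := Finset.sum_nonneg fun _ _ => sq_nonneg _
  set y := ∑ k ∈ T, ⟪b k, x⟫_ℝ • b k with hy
  have hyn : ‖y‖ ^ 2 = s := by
    rw [← real_inner_self_eq_norm_sq, b.orthonormal.inner_sum]
    simp [hs, sq]
  have hyx : ⟪y, x⟫_ℝ = s := by
    rw [hy, sum_inner, hs]
    simp [real_inner_smul_left, sq]
  have hle : s ≤ ‖Nᗮ.starProjection y‖ * ‖x‖ := by
    rw [← hyx, ← Submodule.starProjection_eq_self_iff.2 hx,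
      ← Submodule.inner_starProjection_left_eq_right, Submodule.starProjection_eq_self_iff.2 hx]
    exact real_inner_le_norm _ _
  have h1 := h.gap_mul_norm_orthogonal_le b T hb hT fun k => ⟪b k, x⟫_ℝ
  rw [← hy] at h1
  have hΔ : 0 < Δ := by linarith [h.nonneg, h.two_mul_lt]
  have h2 : Δ * s ≤ 2 * ε * ‖y‖ * ‖x‖ := by
    calc Δ * s ≤ Δ * (‖Nᗮ.starProjection y‖ * ‖x‖) := by gcongr
      _ = Δ * ‖Nᗮ.starProjection y‖ * ‖x‖ := by ring
      _ ≤ _ := by gcongr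
  have h3 : Δ * ‖y‖ ≤ 2 * ε * ‖x‖ := by
    rcases (norm_nonneg y).eq_or_lt with h0 | h0
    · rw [← h0, mul_zero]; have := h.nonneg; positivity
    · refine le_of_mul_le_mul_right ?_ h0
      rw [← hyn] at h2
      nlinarith
  rw [← hyn, ← mul_pow, ← mul_pow]
  gcongr

/-- Used for `u ∈ N`, where `L' u = (L' - L) u` is small: the vectors of `N` are almost
orthogonal to the eigenvectors of large eigenvalues. -/
theorem sum_sq_inner_compl_le [DecidableEq ι] (h : IsGapPerturbation L L' N Δ ε)
    (hb : ∀ k, L' (b k) = ev k • b k) (hT : ∀ k, k ∉ T → Δ - ε ≤ ev k) (u : F) :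
    (Δ - ε) ^ 2 * ∑ k ∈ Tᶜ, ⟪b k, u⟫_ℝ ^ 2 ≤ ‖L' u‖ ^ 2 := by
  rw [← b.sum_sq_inner_right (L' u), Finset.mul_sum]
  refine le_trans (Finset.sum_le_sum fun k hk => ?_)
    (Finset.sum_le_univ_sum_of_nonneg fun k => sq_nonneg _)
  rw [← h.inner_symm', hb, real_inner_smul_left, mul_pow]
  have h0 : 0 ≤ Δ - ε := by linarith [h.nonneg, h.two_mul_lt]
  have := hT k (Finset.mem_compl.1 hk)
  gcongr

/-- There are at most `dim N` small eigenvalues: by the operator norm bound, the projection on `N` is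
injective on the span of their eigenvectors. -/
theorem card_le_finrank (h : IsGapPerturbation L L' N Δ ε)
    (hb : ∀ k, L' (b k) = ev k • b k) (hT : ∀ k ∈ T, |ev k| ≤ ε) :
    T.card ≤ Module.finrank ℝ N := by
  classical
  have hli : LinearIndependent ℝ fun k : T => N.orthogonalProjectionOnto (b k) := by
    rw [Fintype.linearIndependent_iff]
    intro c hc
    set c' : ι → ℝ := fun k => if hk : k ∈ T then c ⟨k, hk⟩ else 0 with hc'
    have hsum : ∑ k : T, c k • b k = ∑ k ∈ T, c' k • b k := by
      rw [← Finset.sum_coe_sort T fun k => c' k • b k]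
      exact Finset.sum_congr rfl fun k _ => by simp [hc']
    have hP : N.orthogonalProjectionOnto (∑ k ∈ T, c' k • b k) = 0 := by
      rw [← hsum, map_sum]; simpa using hc
    have hmem : ∑ k ∈ T, c' k • b k ∈ Nᗮ := N.orthogonalProjectionOnto_eq_zero_iff.1 hP
    have h1 := h.gap_mul_norm_orthogonal_le b T hb hT c'
    rw [Submodule.starProjection_eq_self_iff.2 hmem] at h1
    have h2 : ‖∑ k ∈ T, c' k • b k‖ = 0 := by
      nlinarith [norm_nonneg (∑ k ∈ T, c' k • b k), h.two_mul_lt]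
    rw [norm_eq_zero, ← hsum] at h2
    have hli := b.orthonormal.linearIndependent.comp (fun k : T => (k : ι)) Subtype.val_injective
    exact Fintype.linearIndependent_iff.1 hli c h2
  simpa using hli.fintype_card_le_finrank

/-- If `L'` vanishes on `N` too, the eigenvectors of small eigenvalues are in `N`. -/
theorem starProjection_orthogonal_eq_zero (h : IsGapPerturbation L L' N Δ ε)
    (h0 : ∀ u ∈ N, L' u = 0) {v : F} {l : ℝ} (hv : L' v = l • v) (hl : |l| ≤ ε) :
    Nᗮ.starProjection v = 0 := by
  have h1 := h.norm_orthogonal_le hv hl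
  have h2 : L' v = L' (Nᗮ.starProjection v) := by
    conv_lhs => rw [← N.starProjection_add_starProjection_orthogonal v, map_add,
      h0 _ (N.starProjection_apply_mem v), zero_add]
  have h3 := h.norm_sub_le (Nᗮ.starProjection v)
  rw [← h2, h.map_starProjection] at h3
  rw [← norm_eq_zero]
  nlinarith [norm_nonneg (Nᗮ.starProjection v), h.two_mul_lt]

end IsGapPerturbation

end Perturbation

/-- Lower bound for the part of `x` along some vectors of an orthonormal basis, in terms of the
components of `x` in a subspace and in its orthogonal complement. -/
theorem half_sub_le_sum_sq_inner {F : Type*} [NormedAddCommGroup F]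
    [InnerProductSpace ℝ F] {ι : Type*} [Fintype ι] [DecidableEq ι]
    (b : OrthonormalBasis ι ℝ F) (T : Finset ι) (p q : F) :
    (‖p‖ ^ 2 - ∑ k ∈ Tᶜ, ⟪b k, p⟫_ℝ ^ 2) / 2 - ∑ k ∈ T, ⟪b k, q⟫_ℝ ^ 2
      ≤ ∑ k ∈ T, ⟪b k, p + q⟫_ℝ ^ 2 := by
  rw [← b.sum_sq_inner_right p, ← Finset.sum_add_sum_compl T, add_sub_cancel_right,
    Finset.sum_div, ← Finset.sum_sub_distrib]
  refine Finset.sum_le_sum fun k _ => ?_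
  rw [inner_add_right]
  nlinarith [sq_nonneg (⟪b k, p⟫_ℝ + 2 * ⟪b k, q⟫_ℝ)]

/-! ### Laplacians as operators -/

section Laplacian

variable {d : ℕ}

/-- The Laplacian of the weights `x` as an operator on Euclidean space. -/
noncomputable def lapOp (x : ParamSpace d) :
    EuclideanSpace ℝ (Fin d) →L[ℝ] EuclideanSpace ℝ (Fin d) :=
  Matrix.toEuclideanCLM (𝕜 := ℝ) (lap x)

theorem lapOp_apply (x : ParamSpace d) (v : EuclideanSpace ℝ (Fin d)) (i : Fin d) :
    lapOp x v i = ∑ j, adjMat x i j * (v i - v j) := by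
  change (lap x).mulVec v i = _
  rw [lap, laplacian, Matrix.sub_mulVec, Pi.sub_apply, Matrix.mulVec_diagonal, Finset.sum_mul,
    Matrix.mulVec, dotProduct, ← Finset.sum_sub_distrib]
  exact Finset.sum_congr rfl fun j _ => by ring

theorem lapOp_isSelfAdjoint (x : ParamSpace d) : IsSelfAdjoint (lapOp x) :=
  IsSelfAdjoint.map (lap_isHermitian x : IsSelfAdjoint (lap x))
    (Matrix.toEuclideanCLM (n := Fin d) (𝕜 := ℝ))

theorem adjMat_sub (x y : ParamSpace d) : adjMat (x - y) = adjMat x - adjMat y := by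
  ext i j
  simp only [adjMat, Matrix.of_apply, Matrix.sub_apply]
  split_ifs <;> simp

theorem lapOp_sub (x y : ParamSpace d) : lapOp (x - y) = lapOp x - lapOp y := by
  ext v i
  simp [lapOp_apply, adjMat_sub, sub_mul, Finset.sum_sub_distrib]

theorem norm_lapOp_le (x : ParamSpace d) (v : EuclideanSpace ℝ (Fin d)) :
    ‖lapOp x v‖ ≤ opNorm (lap x) * ‖v‖ :=
  (lapOp x).le_opNorm v

/-- The squared Frobenius norm can be computed in any orthonormal basis. -/
theorem sum_norm_sq_toEuclideanCLM {ι : Type*} [Fintype ι] (A : Matrix (Fin d) (Fin d) ℝ)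
    (b : OrthonormalBasis ι ℝ (EuclideanSpace ℝ (Fin d))) :
    ∑ k, ‖Matrix.toEuclideanCLM (𝕜 := ℝ) A (b k)‖ ^ 2 = frobNorm A ^ 2 := by
  have h : ∀ (v : EuclideanSpace ℝ (Fin d)) i, Matrix.toEuclideanCLM (𝕜 := ℝ) A v i =
      ⟪v, WithLp.toLp 2 (A i)⟫_ℝ := fun v i => by
    rw [PiLp.inner_apply]
    rfl
  rw [frobNorm, Real.sq_sqrt (by positivity)]
  simp_rw [EuclideanSpace.norm_sq_eq, h, Real.norm_eq_abs, sq_abs]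
  rw [Finset.sum_comm]
  refine Finset.sum_congr rfl fun i _ => ?_
  rw [b.sum_sq_inner_right, EuclideanSpace.norm_sq_eq]
  simp

theorem opNorm_le_frobNorm (A : Matrix (Fin d) (Fin d) ℝ) : opNorm A ≤ frobNorm A := by
  refine ContinuousLinearMap.opNorm_le_bound _ (Real.sqrt_nonneg _) fun v => ?_
  refine le_of_sq_le_sq ?_ (mul_nonneg (Real.sqrt_nonneg _) (norm_nonneg _))
  rw [mul_pow, frobNorm, Real.sq_sqrt (by positivity), EuclideanSpace.norm_sq_eq,
    EuclideanSpace.norm_sq_eq, Finset.sum_mul]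
  refine Finset.sum_le_sum fun i _ => ?_
  simp only [Real.norm_eq_abs, sq_abs]
  exact Finset.sum_mul_sq_le_sq_mul_sq Finset.univ (A i) v

/-- The columns of an orthogonal matrix as an orthonormal basis. -/
theorem exists_orthonormalBasis_of_mem_orthogonalGroup {V : Matrix (Fin d) (Fin d) ℝ}
    (hV : V ∈ Matrix.orthogonalGroup (Fin d) ℝ) :
    ∃ b : OrthonormalBasis (Fin d) ℝ (EuclideanSpace ℝ (Fin d)), ∀ k i, b k i = V i k := by
  have hon : Orthonormal ℝ fun k => (WithLp.toLp 2 (V.transpose k) : EuclideanSpace ℝ (Fin d)) := by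
    rw [orthonormal_iff_ite]
    intro k l
    have h := congrFun (congrFun ((Matrix.mem_orthogonalGroup_iff' _ _).1 hV) k) l
    rw [Matrix.mul_apply, Matrix.one_apply] at h
    rw [← h, PiLp.inner_apply]
    refine Finset.sum_congr rfl fun i _ => ?_
    simp [mul_comm]
  have hspan := (hon.linearIndependent.span_eq_top_of_card_eq_finrank' (by simp)).ge
  refine ⟨OrthonormalBasis.mk hon hspan, fun k i => ?_⟩
  rw [OrthonormalBasis.coe_mk]
  rfl

theorem lapOp_eq_smul_of_mul_eq {x : ParamSpace d} {V : Matrix (Fin d) (Fin d) ℝ} {ev : Fin d → ℝ}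
    (h : lap x * V = V * Matrix.diagonal ev) {k : Fin d} {v : EuclideanSpace ℝ (Fin d)}
    (hv : ∀ i, v i = V i k) : lapOp x v = ev k • v := by
  ext i
  have h1 := congrFun (congrFun h i) k
  rw [Matrix.mul_diagonal] at h1
  change (lap x).mulVec v i = ev k * v i
  rw [hv i, mul_comm, ← h1, Matrix.mul_apply, Matrix.mulVec, dotProduct]
  simp_rw [hv]

/-- Eigenvectors and eigenvalues for a step of the algorithm exist. -/
theorem exists_orthogonal_diagonalization (x : ParamSpace d) :
    ∃ V ∈ Matrix.orthogonalGroup (Fin d) ℝ, ∃ ev : Fin d → ℝ,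
      lap x * V = V * Matrix.diagonal ev := by
  refine ⟨(lap_isHermitian x).eigenvectorUnitary, (lap_isHermitian x).eigenvectorUnitary.2,
    (lap_isHermitian x).eigenvalues, ?_⟩
  ext i k
  have h := congrFun ((lap_isHermitian x).mulVec_eigenvectorBasis k) i
  rw [Matrix.mul_diagonal, Matrix.mul_apply]
  simpa [Matrix.mulVec, dotProduct, mul_comm] using h

end Laplacian

/-! ### Vectors that are constant on the components of a graph -/

section Components

variable {d : ℕ}

/-- The vectors that are constant on the connected components of the support graph of `x`; this
is the kernel of the Laplacian of `|x|`. -/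
def compConst (x : ParamSpace d) : Submodule ℝ (EuclideanSpace ℝ (Fin d)) where
  carrier := {v | ∀ i j, (supportGraph x).Reachable i j → v i = v j}
  add_mem' ha hb i j h := by simp [ha i j h, hb i j h]
  zero_mem' i j _ := rfl
  smul_mem' c v hv i j h := by simp [hv i j h]

theorem mem_blockSupport {x : ParamSpace d} {e : Edge d} :
    e ∈ blockSupport x ↔ (supportGraph x).Reachable e.1.1 e.1.2 := by
  simp [blockSupport]

theorem mem_supportedOn_blockSupport (x : ParamSpace d) : x ∈ supportedOn (blockSupport x) := by
  intro e he
  by_contra h0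
  refine he (mem_blockSupport.2 (SimpleGraph.Adj.reachable ?_))
  change adjMat x _ _ ≠ 0
  simpa [adjMat, e.2] using h0

theorem adjMat_eq_zero {x y : ParamSpace d} (hy : y ∈ supportedOn (blockSupport x)) {i j : Fin d}
    (h : ¬ (supportGraph x).Reachable i j) : adjMat y i j = 0 := by
  simp only [adjMat, Matrix.of_apply]
  split_ifs with h1 h2
  · exact hy _ fun he => h (mem_blockSupport.1 he)
  · exact hy _ fun he => h (mem_blockSupport.1 he).symm
  · rfl

theorem absVec_mem_supportedOn {S : Finset (Edge d)} {y : ParamSpace d} (hy : y ∈ supportedOn S) :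
    absVec y ∈ supportedOn S := fun e he => by simp [absVec, hy e he]

/-- Edges inside the blocks do not see the vectors that are constant on the blocks. -/
theorem lapOp_eq_zero_of_mem_compConst {x y : ParamSpace d}
    (hy : y ∈ supportedOn (blockSupport x)) {u : EuclideanSpace ℝ (Fin d)}
    (hu : u ∈ compConst x) : lapOp y u = 0 := by
  ext i
  rw [lapOp_apply]
  refine Finset.sum_eq_zero fun j _ => ?_
  by_cases h : (supportGraph x).Reachable i j
  · rw [hu i j h, sub_self, mul_zero]
  · rw [adjMat_eq_zero hy h, zero_mul]

theorem finrank_compConst (x : ParamSpace d) :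
    Module.finrank ℝ (compConst x) = numComp x := by
  classical
  let G := supportGraph x
  let f : (G.ConnectedComponent → ℝ) →ₗ[ℝ] EuclideanSpace ℝ (Fin d) :=
    { toFun := fun c => WithLp.toLp 2 fun i => c (G.connectedComponentMk i)
      map_add' := fun _ _ => rfl
      map_smul' := fun _ _ => rfl }
  have hinj : Function.Injective f := by
    intro c c' h
    funext t
    induction t using SimpleGraph.ConnectedComponent.ind with
    | h i => exact congrFun (congrArg (fun v : EuclideanSpace ℝ (Fin d) => (v : Fin d → ℝ)) h) i
  have hrange : LinearMap.range f = compConst x := by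
    ext v
    constructor
    · rintro ⟨c, rfl⟩ i j hij
      exact congrArg c (SimpleGraph.ConnectedComponent.sound hij)
    · intro hv
      refine ⟨fun t => t.lift (fun i => v i) fun i j p _ => hv i j ⟨p⟩, ?_⟩
      ext i
      rfl
  rw [← hrange, LinearMap.finrank_range_of_inj hinj, Module.finrank_fintype_fun_eq_card, numComp,
    Nat.card_eq_fintype_card]

/-- The spectral gap of the target, as a lower bound for the quadratic form of the Laplacian on
the orthogonal complement of its kernel. -/
theorem gap_of_le_spectralGap {x : ParamSpace d} {Δ : ℝ} (hΔ : 0 < Δ)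
    (h : (Δ : EReal) ≤ spectralGap x) {v : EuclideanSpace ℝ (Fin d)} (hv : v ∈ (compConst x)ᗮ) :
    Δ * ‖v‖ ^ 2 ≤ ⟪lapOp (absVec x) v, v⟫_ℝ := by
  classical
  set A := lap_isHermitian (absVec x) with hA
  let σ : Fin d ≃ Fin (Fintype.card (Fin d)) := Fin.revPerm.trans
    (finCongr (Fintype.card_fin d).symm)
  let τ : Fin (Fintype.card (Fin d)) ≃ Fin d := Fintype.equivOfCardEq (Fintype.card_fin _)
  let b := A.eigenvectorBasis.reindex (σ.trans τ).symm
  have hb : ∀ k, lapOp (absVec x) (b k) = lapEig (absVec x) k • b k := by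
    intro k
    have h1 := A.mulVec_eigenvectorBasis (τ (σ k))
    have h2 : A.eigenvalues (τ (σ k)) = lapEig (absVec x) k := by
      simp [Matrix.IsHermitian.eigenvalues, lapEig, τ, σ]
    rw [h2] at h1
    have h3 : b k = A.eigenvectorBasis (τ (σ k)) := by simp [b]
    ext i
    rw [h3]
    exact congrFun h1 i
  refine gap_of_card_eigenvalues_le (lapOp_isSelfAdjoint _)
    (fun u hu => lapOp_eq_zero_of_mem_compConst
      (absVec_mem_supportedOn (mem_supportedOn_blockSupport x)) hu)
    b hb hΔ (T := Finset.univ.filter fun k : Fin d => (k : ℕ) < numComp x) ?_ ?_ hv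
  · intro k hk
    have hk' : numComp x ≤ k := by simpa using hk
    have hlt : numComp x < d := hk'.trans_lt k.2
    rw [spectralGap, dif_pos hlt, EReal.coe_le_coe_iff] at h
    refine h.trans (A.eigenvalues₀_antitone ?_)
    rw [Fin.le_def]
    simp only [Fin.val_cast, Fin.val_rev]
    omega
  · rw [finrank_compConst, Fin.card_filter_val_lt]
    exact min_le_right _ _

/-- The difference of the indicator vectors of the two ends of an edge. -/
noncomputable def edgeVec (e : Edge d) : EuclideanSpace ℝ (Fin d) :=
  EuclideanSpace.single e.1.1 1 - EuclideanSpace.single e.1.2 1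

theorem inner_edgeVec (v : EuclideanSpace ℝ (Fin d)) (e : Edge d) :
    ⟪v, edgeVec e⟫_ℝ = v e.1.1 - v e.1.2 := by
  simp [edgeVec, inner_sub_right, EuclideanSpace.inner_single_right]

theorem norm_sq_edgeVec (e : Edge d) : ‖edgeVec e‖ ^ 2 = 2 := by
  rw [← real_inner_self_eq_norm_sq, inner_edgeVec]
  have h := e.2.ne
  simp [edgeVec, h, h.symm]
  norm_num

theorem edgeVec_mem_orthogonal {x : ParamSpace d} {e : Edge d} (he : e ∈ blockSupport x) :
    edgeVec e ∈ (compConst x)ᗮ := by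
  refine (Submodule.mem_orthogonal _ _).2 fun u hu => ?_
  rw [inner_edgeVec, hu _ _ (mem_blockSupport.1 he), sub_self]

open Classical in
theorem card_reachable_le_maxCompSize (x : ParamSpace d) (i : Fin d) :
    (Finset.univ.filter fun j => (supportGraph x).Reachable i j).card ≤ maxCompSize x := by
  have h : (Finset.univ.filter fun j => (supportGraph x).Reachable i j).card =
      ((supportGraph x).connectedComponentMk i).supp.ncard := by
    rw [← Set.ncard_coe_finset]
    congr 1
    ext j
    simp [SimpleGraph.ConnectedComponent.eq, SimpleGraph.reachable_comm]
  rw [h]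
  exact le_ciSup (f := fun c : (supportGraph x).ConnectedComponent => c.supp.ncard)
    (Set.finite_range _).bddAbove _

/-- An edge between two blocks has a component along the vectors that are constant on the blocks:
test against the difference of the normalized indicators of its two blocks. -/
theorem two_div_maxCompSize_le {x : ParamSpace d} {e : Edge d} (he : e ∉ blockSupport x) :
    2 / (maxCompSize x : ℝ) ≤ ‖(compConst x).starProjection (edgeVec e)‖ ^ 2 := by
  classical
  have hnr : ¬ (supportGraph x).Reachable e.1.1 e.1.2 := fun h => he (mem_blockSupport.2 h)
  let c : Fin d → Finset (Fin d) := fun i =>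
    Finset.univ.filter fun j => (supportGraph x).Reachable i j
  have hmem : ∀ i j, j ∈ c i ↔ (supportGraph x).Reachable i j := fun i j => by simp [c]
  have hpos : ∀ i, 0 < ((c i).card : ℝ) := fun i =>
    Nat.cast_pos.2 (Finset.card_pos.2 ⟨i, (hmem i i).2 (SimpleGraph.Reachable.refl i)⟩)
  have hle : ∀ i, 1 / (maxCompSize x : ℝ) ≤ 1 / ((c i).card : ℝ) := fun i =>
    one_div_le_one_div_of_le (hpos i) (Nat.cast_le.2 (card_reachable_le_maxCompSize x i))
  let ind : Fin d → EuclideanSpace ℝ (Fin d) := fun i =>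
    WithLp.toLp 2 fun j => if j ∈ c i then 1 / ((c i).card : ℝ) else 0
  have hind : ∀ i, ind i ∈ compConst x := by
    intro i j k hjk
    have : j ∈ c i ↔ k ∈ c i := by
      rw [hmem, hmem]
      exact ⟨fun h => h.trans hjk, fun h => h.trans hjk.symm⟩
    simp [ind, this]
  set i := e.1.1
  set j := e.1.2
  set u := ind i - ind j with hu
  have huN : u ∈ compConst x := Submodule.sub_mem _ (hind i) (hind j)
  have hinner : ⟪u, edgeVec e⟫_ℝ = 1 / ((c i).card : ℝ) + 1 / ((c j).card : ℝ) := by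
    rw [inner_edgeVec]
    have h1 : j ∉ c i := fun h => hnr ((hmem _ _).1 h)
    have h2 : i ∉ c j := fun h => hnr ((hmem _ _).1 h).symm
    have h3 : ∀ k, k ∈ c k := fun k => (hmem k k).2 (SimpleGraph.Reachable.refl k)
    change (ind i i - ind j i) - (ind i j - ind j j) = _
    simp [ind, h1, h2, h3]
  have hnorm : ‖u‖ ^ 2 = 1 / ((c i).card : ℝ) + 1 / ((c j).card : ℝ) := by
    have hdisj : ∀ k, k ∈ c i → k ∉ c j := fun k h1 h2 =>
      hnr (((hmem _ _).1 h1).trans ((hmem _ _).1 h2).symm)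
    have hsq : ∀ k, u k ^ 2 = (if k ∈ c i then (1 / ((c i).card : ℝ)) ^ 2 else 0) +
        (if k ∈ c j then (1 / ((c j).card : ℝ)) ^ 2 else 0) := by
      intro k
      change (ind i k - ind j k) ^ 2 = _
      by_cases h1 : k ∈ c i
      · simp [ind, h1, hdisj k h1]
      · by_cases h2 : k ∈ c j <;> simp [ind, h1, h2]
    rw [EuclideanSpace.norm_sq_eq]
    simp_rw [Real.norm_eq_abs, sq_abs, hsq, Finset.sum_add_distrib, Finset.sum_ite_mem,
      Finset.univ_inter, Finset.sum_const, nsmul_eq_mul]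
    have := hpos i
    have := hpos j
    field_simp
  have hpair : ⟪u, edgeVec e⟫_ℝ = ⟪u, (compConst x).starProjection (edgeVec e)⟫_ℝ := by
    rw [← Submodule.inner_starProjection_left_eq_right,
      Submodule.starProjection_eq_self_iff.2 huN]
  have hcs := real_inner_le_norm u ((compConst x).starProjection (edgeVec e))
  rw [← hpair, hinner, ← hnorm] at hcs
  have hupos : 0 < ‖u‖ := by
    have h1 : 0 < ‖u‖ ^ 2 := by
      rw [hnorm]
      have := hpos i
      have := hpos j
      positivity
    exact (norm_nonneg u).lt_of_ne fun h0 => by simp [← h0] at h1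
  have hfin : ‖u‖ ≤ ‖(compConst x).starProjection (edgeVec e)‖ := by
    refine le_of_mul_le_mul_left ?_ hupos
    rwa [← sq]
  calc 2 / (maxCompSize x : ℝ) = 1 / (maxCompSize x : ℝ) + 1 / (maxCompSize x : ℝ) := by ring
    _ ≤ ‖u‖ ^ 2 := by rw [hnorm]; exact add_le_add (hle i) (hle j)
    _ ≤ _ := by gcongr

/-- The unweighted Laplacian of the union of the complete graphs on the blocks has norm at most
twice the largest block size. -/
theorem sum_sq_sub_le (x : ParamSpace d) (q : EuclideanSpace ℝ (Fin d)) :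
    ∑ e ∈ blockSupport x, (q e.1.1 - q e.1.2) ^ 2 ≤ 2 * maxCompSize x * ‖q‖ ^ 2 := by
  classical
  let R : Fin d × Fin d → ℝ := fun p =>
    if (supportGraph x).Reachable p.1 p.2 then q p.1 ^ 2 else 0
  have hR : ∀ p, 0 ≤ R p := fun p => by dsimp only [R]; split_ifs <;> positivity
  have hRsum : ∑ p, R p ≤ maxCompSize x * ‖q‖ ^ 2 := by
    rw [EuclideanSpace.norm_sq_eq, Finset.mul_sum, Fintype.sum_prod_type]
    refine Finset.sum_le_sum fun i _ => ?_
    simp only [R]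
    rw [← Finset.sum_filter, Finset.sum_const, nsmul_eq_mul, Real.norm_eq_abs, sq_abs]
    have : ((Finset.univ.filter fun j => (supportGraph x).Reachable i j).card : ℝ)
        ≤ maxCompSize x := Nat.cast_le.2 (card_reachable_le_maxCompSize x i)
    gcongr
  have hfst : ∑ e ∈ blockSupport x, q e.1.1 ^ 2 + ∑ e ∈ blockSupport x, q e.1.2 ^ 2
      ≤ ∑ p, R p := by
    have h1 : ∑ e ∈ blockSupport x, q e.1.1 ^ 2
        = ∑ p ∈ (blockSupport x).image (fun e : Edge d => e.1), R p := by
      rw [Finset.sum_image fun _ _ _ _ h => Subtype.ext h]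
      exact Finset.sum_congr rfl fun e he => by simp [R, mem_blockSupport.1 he]
    have h2 : ∑ e ∈ blockSupport x, q e.1.2 ^ 2
        = ∑ p ∈ (blockSupport x).image (fun e : Edge d => e.1.swap), R p := by
      rw [Finset.sum_image fun _ _ _ _ h => Subtype.ext (Prod.swap_injective h)]
      exact Finset.sum_congr rfl fun e he => by simp [R, (mem_blockSupport.1 he).symm]
    rw [h1, h2, ← Finset.sum_union]
    · exact Finset.sum_le_univ_sum_of_nonneg hR
    · rw [Finset.disjoint_left]
      rintro p hp hp'
      obtain ⟨e, -, rfl⟩ := Finset.mem_image.1 hp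
      obtain ⟨e', -, h⟩ := Finset.mem_image.1 hp'
      have h3 := e.2
      rw [← h] at h3
      exact absurd e'.2 h3.not_gt
  calc ∑ e ∈ blockSupport x, (q e.1.1 - q e.1.2) ^ 2
      ≤ ∑ e ∈ blockSupport x, 2 * (q e.1.1 ^ 2 + q e.1.2 ^ 2) :=
        Finset.sum_le_sum fun e _ => by nlinarith [sq_nonneg (q e.1.1 + q e.1.2)]
    _ = 2 * (∑ e ∈ blockSupport x, q e.1.1 ^ 2 + ∑ e ∈ blockSupport x, q e.1.2 ^ 2) := by
        rw [← Finset.mul_sum, Finset.sum_add_distrib]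
    _ ≤ 2 * (maxCompSize x * ‖q‖ ^ 2) := by linarith
    _ = _ := by ring

end Components

/-! ### Convex losses with a weighted Lasso penalty -/

theorem le_fderiv_apply_of_forall_le {E : Type*} [NormedAddCommGroup E] [NormedSpace ℝ E]
    {f : E → ℝ} {f' : E →L[ℝ] ℝ} {a h : E} {c : ℝ} (hf : HasFDerivAt f f' a)
    (hc : ∀ t : ℝ, 0 < t → t ≤ 1 → f a + t * c ≤ f (a + t • h)) : c ≤ f' h := by
  have hline : HasDerivAt (fun t : ℝ => a + t • h) h 0 := by
    simpa using ((hasDerivAt_id (0 : ℝ)).smul_const h).const_add a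
  have hφ : HasDerivAt (fun t : ℝ => f (a + t • h)) (f' h) 0 := by
    refine HasFDerivAt.comp_hasDerivAt 0 ?_ hline
    simpa using hf
  have hslope := (hasDerivAt_iff_tendsto_slope_zero.1 hφ).mono_left
    (nhdsWithin_mono 0 fun t (ht : t ∈ Ioi 0) => (mem_Ioi.1 ht).ne')
  refine ge_of_tendsto hslope ?_
  filter_upwards [Ioc_mem_nhdsGT (zero_lt_one' ℝ)] with t ht
  have h1 := hc t ht.1 ht.2
  simp only [zero_add, zero_smul, add_zero, smul_eq_mul]
  rw [inv_mul_eq_div, le_div_iff₀ ht.1]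
  linarith

theorem ConvexOn.fderiv_apply_sub_le {E : Type*} [NormedAddCommGroup E] [NormedSpace ℝ E]
    {f : E → ℝ} (hconv : ConvexOn ℝ univ f) {f' : E →L[ℝ] ℝ} {a : E} (hf : HasFDerivAt f f' a)
    (x : E) : f a + f' (x - a) ≤ f x := by
  have h := le_fderiv_apply_of_forall_le (h := x - a) (c := -(f x - f a)) hf.neg fun t h0 h1 => by
    have h2 := hconv.2 (mem_univ a) (mem_univ x) (sub_nonneg.2 h1) h0.le (by ring)
    have h3 : (1 - t) • a + t • x = a + t • (x - a) := by module
    rw [h3] at h2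
    simp only [smul_eq_mul] at h2
    simp only [Pi.neg_apply]
    linarith
  simp only [neg_apply] at h
  linarith

section Lasso

variable {d : ℕ}

/-- Restriction of a vector to the entries in `S`. -/
noncomputable def restrictTo (S : Finset (Edge d)) (x : ParamSpace d) : ParamSpace d :=
  WithLp.toLp 2 fun e => if e ∈ S then x e else 0

/-- First-order optimality of a Lasso oracle on its subspace, in the form of a variational
inequality for the gradient of the loss. -/
theorem IsLassoOracle.variational_inequality {loss : ParamSpace d → ℝ}
    (hdiff : Differentiable ℝ loss) {S : Finset (Edge d)} {w : Edge d → ℝ} (hw : ∀ e, 0 ≤ w e)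
    {b : ParamSpace d} (hb : IsLassoOracle loss S w b) {x : ParamSpace d}
    (hx : x ∈ supportedOn S) :
    0 ≤ ⟪gradient loss b, x - b⟫_ℝ
      + 1 / 2 * (∑ e ∈ S, w e * |x e| - ∑ e ∈ S, w e * |b e|) := by
  have hgrad := (hdiff b).hasGradientAt.hasFDerivAt
  have h := le_fderiv_apply_of_forall_le (h := x - b)
    (c := -(1 / 2 * (∑ e ∈ S, w e * |x e| - ∑ e ∈ S, w e * |b e|))) hgrad fun t h0 h1 => by
      have hmem : b + t • (x - b) ∈ supportedOn S := fun e he => by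
        simp [hb.1 e he, hx e he]
      have hmin := hb.2 hmem
      simp only [mem_ofPred_eq] at hmin
      have hpen : ∑ e ∈ S, w e * |(b + t • (x - b)) e|
          ≤ (1 - t) * ∑ e ∈ S, w e * |b e| + t * ∑ e ∈ S, w e * |x e| := by
        rw [Finset.mul_sum, Finset.mul_sum, ← Finset.sum_add_distrib]
        refine Finset.sum_le_sum fun e _ => ?_
        have h2 : |(b + t • (x - b)) e| ≤ (1 - t) * |b e| + t * |x e| := by
          have h3 : (b + t • (x - b)) e = (1 - t) * b e + t * x e := by
            simp only [PiLp.add_apply, PiLp.smul_apply, PiLp.sub_apply, smul_eq_mul]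
            ring
          rw [h3]
          refine (abs_add_le _ _).trans ?_
          rw [abs_mul, abs_mul, abs_of_nonneg (sub_nonneg.2 h1), abs_of_pos h0]
        calc w e * |(b + t • (x - b)) e| ≤ w e * ((1 - t) * |b e| + t * |x e|) :=
              mul_le_mul_of_nonneg_left h2 (hw e)
          _ = _ := by ring
      linarith
  rw [InnerProductSpace.toDual_apply_apply] at h
  linarith

/-- If the weights outside `S` dominate the gradient of the loss strictly, a unique Lasso oracle
is the unique minimizer of the whole penalized problem. -/
theorem isMinOn_penalized_iff {loss : ParamSpace d → ℝ} (hconv : ConvexOn ℝ univ loss)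
    (hdiff : Differentiable ℝ loss) {S : Finset (Edge d)} {w m : Edge d → ℝ}
    (hw : ∀ e, 0 ≤ w e) (hwm : ∀ e ∈ S, w e = m e)
    {b : ParamSpace d} (hb : IsLassoOracle loss S w b)
    (huniq : ∀ β, IsLassoOracle loss S w β → β = b)
    (hgrad : ∀ e, e ∉ S → |gradient loss b e| < m e / 2) (β : ParamSpace d) :
    IsMinOn (fun x : ParamSpace d => loss x + 1 / 2 * ∑ e, |x e| * m e) univ β ↔ β = b := by
  classical
  have hsplit : ∀ x : ParamSpace d, ∑ e, |x e| * m e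
      = ∑ e ∈ S, w e * |x e| + ∑ e ∈ Sᶜ, |x e| * m e := fun x => by
    rw [← Finset.sum_add_sum_compl S]
    congr 1
    exact Finset.sum_congr rfl fun e he => by rw [hwm e he, mul_comm]
  have hsupp : ∀ x ∈ supportedOn S, ∑ e, |x e| * m e = ∑ e ∈ S, w e * |x e| := fun x hx => by
    rw [hsplit, Finset.sum_eq_zero (s := Sᶜ), add_zero]
    intro e he
    rw [hx e (Finset.mem_compl.1 he), abs_zero, zero_mul]
  have key : ∀ x : ParamSpace d, loss b + 1 / 2 * ∑ e, |b e| * m e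
      + ∑ e ∈ Sᶜ, (m e / 2 - |gradient loss b e|) * |x e| ≤ loss x + 1 / 2 * ∑ e, |x e| * m e := by
    intro x
    have hmem : restrictTo S x ∈ supportedOn S := fun e he => by simp [restrictTo, he]
    have h1 := hb.variational_inequality hdiff hw hmem
    have h2 := hconv.fderiv_apply_sub_le (hdiff b).hasGradientAt.hasFDerivAt x
    rw [InnerProductSpace.toDual_apply_apply] at h2
    have h3 : ∑ e ∈ S, w e * |restrictTo S x e| = ∑ e ∈ S, w e * |x e| :=
      Finset.sum_congr rfl fun e he => by simp [restrictTo, he]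
    have h4 : ⟪gradient loss b, x - b⟫_ℝ = ⟪gradient loss b, restrictTo S x - b⟫_ℝ
        + ∑ e ∈ Sᶜ, gradient loss b e * x e := by
      have h5 : x - b = (restrictTo S x - b) + (x - restrictTo S x) := by abel
      rw [h5, inner_add_right]
      congr 1
      rw [PiLp.inner_apply, ← Finset.sum_add_sum_compl S, Finset.sum_eq_zero, zero_add]
      · refine Finset.sum_congr rfl fun e he => ?_
        simp [restrictTo, Finset.mem_compl.1 he, mul_comm]
      · intro e he
        simp [restrictTo, he]
    have h6 : ∑ e ∈ Sᶜ, (m e / 2 - |gradient loss b e|) * |x e|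
        ≤ 1 / 2 * ∑ e ∈ Sᶜ, |x e| * m e + ∑ e ∈ Sᶜ, gradient loss b e * x e := by
      rw [Finset.mul_sum, ← Finset.sum_add_distrib]
      refine Finset.sum_le_sum fun e _ => ?_
      have := neg_abs_le (gradient loss b e * x e)
      rw [abs_mul] at this
      linarith
    rw [hsplit x, hsupp b hb.1]
    rw [h3] at h1
    linarith
  have hnonneg : ∀ x : ParamSpace d, ∀ e ∈ Sᶜ,
      0 ≤ (m e / 2 - |gradient loss b e|) * |x e| := fun x e he =>
    mul_nonneg (sub_nonneg.2 (hgrad e (Finset.mem_compl.1 he)).le) (abs_nonneg _)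
  constructor
  · intro hβ
    have h1 : loss β + 1 / 2 * ∑ e, |β e| * m e ≤ loss b + 1 / 2 * ∑ e, |b e| * m e :=
      hβ (mem_univ b)
    have h2 : ∑ e ∈ Sᶜ, (m e / 2 - |gradient loss b e|) * |β e| = 0 :=
      le_antisymm (by linarith [key β]) (Finset.sum_nonneg (hnonneg β))
    have hmem : β ∈ supportedOn S := fun e he => by
      have h3 := (Finset.sum_eq_zero_iff_of_nonneg (hnonneg β)).1 h2 e (Finset.mem_compl.2 he)
      exact abs_eq_zero.1 ((mul_eq_zero.1 h3).resolve_left (sub_pos.2 (hgrad e he)).ne')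
    refine huniq β ⟨hmem, fun x hx => ?_⟩
    have h4 := hβ (mem_univ x)
    simp only [mem_ofPred_eq] at h4 ⊢
    rwa [hsupp β hmem, hsupp x hx] at h4
  · rintro rfl x -
    have := Finset.sum_nonneg (hnonneg x)
    simp only [mem_ofPred_eq]
    linarith [key x]

end Lasso

/-! ### The weights of a step of the algorithm -/

namespace IsScadLike

variable {a₀ a₁ b₁ b₂ τ : ℝ} {g : ℝ → ℝ}

theorem a₀_pos (hg : IsScadLike a₀ a₁ b₁ b₂ τ g) : 0 < a₀ := hg.a₁_pos.trans_le hg.a₁_le_a₀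

theorem penaltyDeriv_of_nonpos (hg : IsScadLike a₀ a₁ b₁ b₂ τ g) {t : ℝ} (ht : t ≤ 0) :
    penaltyDeriv g t = a₀ * τ := by
  rw [penaltyDeriv, if_neg ht.not_gt]
  exact hg.tendsto_deriv.limUnder_eq

theorem penaltyDeriv_le (hg : IsScadLike a₀ a₁ b₁ b₂ τ g) (t : ℝ) :
    penaltyDeriv g t ≤ a₀ * τ := by
  rcases le_or_gt t 0 with ht | ht
  · exact (hg.penaltyDeriv_of_nonpos ht).le
  · rw [penaltyDeriv, if_pos ht]
    have hanti := (hg.concaveOn.subset Ioi_subset_Ici_self (convex_Ioi 0)).antitoneOn_deriv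
      fun x hx => hg.differentiableAt x hx
    refine ge_of_tendsto hg.tendsto_deriv ?_
    filter_upwards [Ioc_mem_nhdsGT ht] with s hs
    exact hanti hs.1 ht hs.2

theorem le_penaltyDeriv (hg : IsScadLike a₀ a₁ b₁ b₂ τ g) (hτ : 0 ≤ τ) {t : ℝ}
    (ht : t ≤ b₁ * τ) : a₁ * τ ≤ penaltyDeriv g t := by
  rcases le_or_gt t 0 with h0 | h0
  · rw [hg.penaltyDeriv_of_nonpos h0]
    exact mul_le_mul_of_nonneg_right hg.a₁_le_a₀ hτ
  · exact hg.le_deriv t h0 ht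

end IsScadLike

section Weights

variable {d : ℕ} {βstar : ParamSpace d} {a₀ a₁ b₁ b₂ τ : ℝ} {g : ℝ → ℝ}

theorem isGapPerturbation_lapOp (hb₁ : 0 < b₁) (hb : b₁ < b₂) (hτ : 0 < τ)
    (hgap : (((b₁ + b₂) * τ : ℝ) : EReal) ≤ spectralGap βstar) {x : ParamSpace d}
    (hx : opNorm (lap (absVec x - absVec βstar)) < b₁ * τ) :
    IsGapPerturbation (lapOp (absVec βstar)) (lapOp (absVec x)) (compConst βstar)
      ((b₁ + b₂) * τ) (opNorm (lap (absVec x - absVec βstar))) where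
  symm := lapOp_isSelfAdjoint _
  symm' := lapOp_isSelfAdjoint _
  map_zero _ hu := lapOp_eq_zero_of_mem_compConst
    (absVec_mem_supportedOn (mem_supportedOn_blockSupport βstar)) hu
  gap _ hv := gap_of_le_spectralGap (by have := hb₁.trans hb; positivity) hgap hv
  norm_sub_le v := by
    have h := norm_lapOp_le (absVec x - absVec βstar) v
    rwa [lapOp_sub] at h
  nonneg := norm_nonneg _
  two_mul_lt := by nlinarith

/-- In a step from a vector close to the target, the penalty only sees the eigenvectors of small
eigenvalues, and its derivative there is between `a₁ τ` and `a₀ τ`. -/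
theorem exists_eigenbasis (hg : IsScadLike a₀ a₁ b₁ b₂ τ g) (hτ : 0 < τ)
    (hgap : (((b₁ + b₂) * τ : ℝ) : EReal) ≤ spectralGap βstar) {x : ParamSpace d}
    (hx : opNorm (lap (absVec x - absVec βstar)) < b₁ * τ)
    {V : Matrix (Fin d) (Fin d) ℝ} (hV : V ∈ Matrix.orthogonalGroup (Fin d) ℝ) {ev : Fin d → ℝ}
    (hev : lap (absVec x) * V = V * Matrix.diagonal ev) :
    ∃ (b : OrthonormalBasis (Fin d) ℝ (EuclideanSpace ℝ (Fin d))) (T : Finset (Fin d)),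
      (∀ k, lapOp (absVec x) (b k) = ev k • b k) ∧
      (∀ k ∈ T, |ev k| ≤ opNorm (lap (absVec x - absVec βstar))) ∧
      (∀ k, k ∉ T → (b₁ + b₂) * τ - opNorm (lap (absVec x - absVec βstar)) ≤ ev k) ∧
      (∀ e, a₁ * τ * ∑ k ∈ T, ⟪b k, edgeVec e⟫_ℝ ^ 2
        ≤ lapCoeff V (fun k => penaltyDeriv g (ev k)) e) ∧
      ∀ e, lapCoeff V (fun k => penaltyDeriv g (ev k)) e
        ≤ a₀ * τ * ∑ k ∈ T, ⟪b k, edgeVec e⟫_ℝ ^ 2 := by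
  classical
  obtain ⟨b, hb⟩ := exists_orthonormalBasis_of_mem_orthogonalGroup hV
  have hpert := isGapPerturbation_lapOp hg.b₁_pos hg.b₁_lt_b₂ hτ hgap hx
  set ε := opNorm (lap (absVec x - absVec βstar)) with hε
  have heig : ∀ k, lapOp (absVec x) (b k) = ev k • b k := fun k =>
    lapOp_eq_smul_of_mul_eq hev (hb k)
  set T : Finset (Fin d) := Finset.univ.filter fun k => |ev k| ≤ ε with hT
  have hlarge : ∀ k, k ∉ T → (b₁ + b₂) * τ - ε ≤ ev k := fun k hk =>
    (hpert.abs_le_or_le (b.orthonormal.1 k) (heig k)).resolve_left (by simpa [hT] using hk)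
  have hcoeff : ∀ e, lapCoeff V (fun k => penaltyDeriv g (ev k)) e
      = ∑ k ∈ T, penaltyDeriv g (ev k) * ⟪b k, edgeVec e⟫_ℝ ^ 2 := fun e => by
    rw [lapCoeff]
    symm
    simp_rw [inner_edgeVec, hb]
    refine Finset.sum_subset (Finset.subset_univ T) fun k _ hk => ?_
    rw [hg.deriv_eq_zero (ev k) (by linarith [hlarge k hk]), zero_mul]
  have hsmall : ∀ k ∈ T, |ev k| ≤ ε := fun k hk => by simpa [hT] using hk
  refine ⟨b, T, heig, hsmall, hlarge, fun e => ?_, fun e => ?_⟩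
  · rw [hcoeff, Finset.mul_sum]
    refine Finset.sum_le_sum fun k hk => ?_
    have := hg.le_penaltyDeriv hτ.le (((le_abs_self _).trans (hsmall k hk)).trans hx.le)
    gcongr
  · rw [hcoeff, Finset.mul_sum]
    refine Finset.sum_le_sum fun k _ => ?_
    have := hg.penaltyDeriv_le (ev k)
    gcongr

/-- The weights of a step from a vector that is close to the target and supported on the blocks:
they vanish inside the blocks and are large between the blocks. -/
theorem lapCoeff_of_mem_supportedOn (hg : IsScadLike a₀ a₁ b₁ b₂ τ g) (hτ : 0 < τ)
    (hgap : (((b₁ + b₂) * τ : ℝ) : EReal) ≤ spectralGap βstar) {x : ParamSpace d}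
    (hx : opNorm (lap (absVec x - absVec βstar)) < b₁ * τ)
    (hS : x ∈ supportedOn (blockSupport βstar)) (hmax : 0 < maxCompSize βstar)
    {V : Matrix (Fin d) (Fin d) ℝ} (hV : V ∈ Matrix.orthogonalGroup (Fin d) ℝ) {ev : Fin d → ℝ}
    (hev : lap (absVec x) * V = V * Matrix.diagonal ev) :
    (∀ e ∈ blockSupport βstar, lapCoeff V (fun k => penaltyDeriv g (ev k)) e = 0) ∧
    ∀ e, e ∉ blockSupport βstar → a₁ * τ / (4 * maxCompSize βstar)
      < lapCoeff V (fun k => penaltyDeriv g (ev k)) e / 2 := by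
  classical
  have hpert := isGapPerturbation_lapOp hg.b₁_pos hg.b₁_lt_b₂ hτ hgap hx
  obtain ⟨b, T, heig, hsmall, hlarge, hlow, hup⟩ := exists_eigenbasis hg hτ hgap hx hV hev
  set ε := opNorm (lap (absVec x - absVec βstar)) with hε
  set N := compConst βstar with hN
  have hzero : ∀ u ∈ N, lapOp (absVec x) u = 0 := fun u hu =>
    lapOp_eq_zero_of_mem_compConst (absVec_mem_supportedOn hS) hu
  have horth : ∀ k ∈ T, ∀ q ∈ Nᗮ, ⟪b k, q⟫_ℝ = 0 := fun k hk q hq => by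
    rw [← Submodule.starProjection_eq_self_iff.2 hq, ← Submodule.inner_starProjection_left_eq_right,
      hpert.starProjection_orthogonal_eq_zero hzero (heig k) (hsmall k hk), inner_zero_left]
  have hpos := mul_pos hg.a₁_pos hτ
  have hmax' : (0 : ℝ) < maxCompSize βstar := Nat.cast_pos.2 hmax
  refine ⟨fun e he => ?_, fun e he => ?_⟩
  · have hsum : ∑ k ∈ T, ⟪b k, edgeVec e⟫_ℝ ^ 2 = 0 := Finset.sum_eq_zero fun k hk => by
      rw [horth k hk _ (edgeVec_mem_orthogonal he)]; simp
    have h1 := hlow e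
    have h2 := hup e
    rw [hsum, mul_zero] at h1 h2
    exact le_antisymm h2 h1
  · have hhalf := half_sub_le_sum_sq_inner b T (N.starProjection (edgeVec e))
      (Nᗮ.starProjection (edgeVec e))
    rw [N.starProjection_add_starProjection_orthogonal, Finset.sum_eq_zero (s := T) fun k hk => by
      rw [horth k hk _ (Nᗮ.starProjection_apply_mem _)]; simp] at hhalf
    have hcompl := hpert.sum_sq_inner_compl_le b T heig hlarge (N.starProjection (edgeVec e))
    rw [hzero _ (N.starProjection_apply_mem _), norm_zero] at hcompl
    have hc : ∑ k ∈ Tᶜ, ⟪b k, N.starProjection (edgeVec e)⟫_ℝ ^ 2 ≤ 0 := by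
      have h1 : 0 < ((b₁ + b₂) * τ - ε) ^ 2 :=
        pow_pos (by linarith [hpert.two_mul_lt, hpert.nonneg]) 2
      refine le_of_mul_le_mul_left ?_ h1
      simpa using hcompl
    have hp := two_div_maxCompSize_le he
    have h2 : 1 / (maxCompSize βstar : ℝ) ≤ ∑ k ∈ T, ⟪b k, edgeVec e⟫_ℝ ^ 2 := by
      have : 2 / (maxCompSize βstar : ℝ) = 2 * (1 / (maxCompSize βstar : ℝ)) := by ring
      linarith
    have h3 := hlow e
    have h4 : a₁ * τ * (1 / (maxCompSize βstar : ℝ))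
        ≤ a₁ * τ * ∑ k ∈ T, ⟪b k, edgeVec e⟫_ℝ ^ 2 := by gcongr
    have h5 : a₁ * τ / (4 * maxCompSize βstar) = a₁ * τ * (1 / (maxCompSize βstar : ℝ)) / 4 := by
      field_simp
    have h6 : 0 < a₁ * τ * (1 / (maxCompSize βstar : ℝ)) := by positivity
    linarith

/-- The weights of a step from a vector that is close to the target: small inside the blocks,
large between the blocks. -/
theorem lapCoeff_of_close (hg : IsScadLike a₀ a₁ b₁ b₂ τ g) (hτ : 0 < τ) {ρ : ℝ}
    (hgap : (((b₁ + b₂) * τ : ℝ) : EReal) ≤ spectralGap βstar) {x : ParamSpace d}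
    (hx : opNorm (lap (absVec x - absVec βstar)) < b₁ * τ)
    (hxρ : opNorm (lap (absVec x - absVec βstar)) ≤ ρ * ((b₁ + b₂) * τ))
    (hxs : opNorm (lap (absVec x - absVec βstar))
      ≤ 1 / 2 ^ 6 * Real.sqrt (a₁ / (a₀ * maxCompSize βstar)) * ((b₁ + b₂) * τ))
    (hmax : 0 < maxCompSize βstar)
    {V : Matrix (Fin d) (Fin d) ℝ} (hV : V ∈ Matrix.orthogonalGroup (Fin d) ℝ) {ev : Fin d → ℝ}
    (hev : lap (absVec x) * V = V * Matrix.diagonal ev) :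
    (∀ e, 0 ≤ lapCoeff V (fun k => penaltyDeriv g (ev k)) e) ∧
    (∀ e ∈ blockSupport βstar,
      lapCoeff V (fun k => penaltyDeriv g (ev k)) e ≤ 8 * a₀ * τ * ρ ^ 2) ∧
    (∀ e, e ∉ blockSupport βstar → a₁ * τ / (4 * maxCompSize βstar)
      < lapCoeff V (fun k => penaltyDeriv g (ev k)) e / 2) ∧
    (residFrob βstar (absVec x - absVec βstar) ≤ ρ * ((b₁ + b₂) * τ) →
      ∑ e ∈ blockSupport βstar, lapCoeff V (fun k => penaltyDeriv g (ev k)) e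
        ≤ 8 * maxCompSize βstar * a₀ * τ * ρ ^ 2) := by
  classical
  have hpert := isGapPerturbation_lapOp hg.b₁_pos hg.b₁_lt_b₂ hτ hgap hx
  obtain ⟨b, T, heig, hsmall, hlarge, hlow, hup⟩ := exists_eigenbasis hg hτ hgap hx hV hev
  set E := lap (absVec x - absVec βstar) with hE
  set ε := opNorm E with hε
  set N := compConst βstar with hN
  set Δ := (b₁ + b₂) * τ with hΔdef
  have ha₀ := hg.a₀_pos
  have hε0 : 0 ≤ ε := hpert.nonneg
  have hεΔ := hpert.two_mul_lt
  have hΔ : 0 < Δ := by linarith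
  have hpos := mul_pos hg.a₁_pos hτ
  have hpos₀ := mul_pos ha₀ hτ
  have hmax' : (0 : ℝ) < maxCompSize βstar := Nat.cast_pos.2 hmax
  have hρ2 : ε ^ 2 ≤ ρ ^ 2 * Δ ^ 2 := by rw [← mul_pow]; gcongr
  -- The factor `a₁ / (a₀ d_max)` is at most `1 / d_max`, hence at most `1`.
  have hs2 : 1024 * (2 * ε) ^ 2 ≤ 1 / (maxCompSize βstar : ℝ) * Δ ^ 2 := by
    have h1 : ε ^ 2 ≤ (1 / 2 ^ 6 * Real.sqrt (a₁ / (a₀ * maxCompSize βstar)) * Δ) ^ 2 := by gcongr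
    rw [mul_pow, mul_pow, Real.sq_sqrt (by have := hg.a₁_pos; positivity)] at h1
    have h2 : a₁ / (a₀ * maxCompSize βstar) ≤ 1 / (maxCompSize βstar : ℝ) := by
      rw [div_le_div_iff₀ (by positivity) hmax']
      have := hg.a₁_le_a₀
      nlinarith
    have h3 : a₁ / (a₀ * maxCompSize βstar) * Δ ^ 2 ≤ 1 / (maxCompSize βstar : ℝ) * Δ ^ 2 := by
      gcongr
    linarith
  have hdle : 1 / (maxCompSize βstar : ℝ) ≤ 1 := by
    rw [div_le_one hmax']
    exact_mod_cast hmax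
  have hperp : ∀ q ∈ Nᗮ, Δ ^ 2 * ∑ k ∈ T, ⟪b k, q⟫_ℝ ^ 2 ≤ (2 * ε) ^ 2 * ‖q‖ ^ 2 := fun q hq =>
    hpert.sum_sq_inner_orthogonal_le b T heig hsmall hq
  refine ⟨fun e => ?_, fun e he => ?_, fun e he => ?_, fun hres => ?_⟩
  · refine le_trans ?_ (hlow e)
    have : 0 ≤ ∑ k ∈ T, ⟪b k, edgeVec e⟫_ℝ ^ 2 := Finset.sum_nonneg fun _ _ => sq_nonneg _
    positivity
  · have h1 := hperp _ (edgeVec_mem_orthogonal he)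
    rw [norm_sq_edgeVec] at h1
    have h2 : ∑ k ∈ T, ⟪b k, edgeVec e⟫_ℝ ^ 2 ≤ 8 * ρ ^ 2 := by
      refine le_of_mul_le_mul_left ?_ (pow_pos hΔ 2)
      linarith
    calc _ ≤ a₀ * τ * ∑ k ∈ T, ⟪b k, edgeVec e⟫_ℝ ^ 2 := hup e
      _ ≤ a₀ * τ * (8 * ρ ^ 2) := by gcongr
      _ = _ := by ring
  · set D := 1 / (maxCompSize βstar : ℝ) with hD
    have hD0 : 0 < D := by positivity
    set p := N.starProjection (edgeVec e) with hp
    set q := Nᗮ.starProjection (edgeVec e) with hq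
    have hhalf := half_sub_le_sum_sq_inner b T p q
    rw [hp, hq, N.starProjection_add_starProjection_orthogonal, ← hp, ← hq] at hhalf
    have hp2 : 2 * D ≤ ‖p‖ ^ 2 := by
      have h1 := two_div_maxCompSize_le he
      have h2 : 2 / (maxCompSize βstar : ℝ) = 2 * D := by rw [hD]; ring
      rwa [h2] at h1
    have hq2 : ‖q‖ ^ 2 ≤ 2 := by
      rw [← norm_sq_edgeVec e, N.norm_sq_eq_add_norm_sq_starProjection (edgeVec e)]
      linarith [sq_nonneg ‖p‖]
    have hcompl := hpert.sum_sq_inner_compl_le b T heig hlarge p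
    have hEp : ‖lapOp (absVec x) p‖ ≤ ε * ‖p‖ := by
      have h1 := hpert.norm_sub_le p
      rwa [hpert.map_zero p (N.starProjection_apply_mem _), sub_zero] at h1
    set A := ∑ k ∈ Tᶜ, ⟪b k, p⟫_ℝ ^ 2 with hA
    have hA0 : 0 ≤ A := Finset.sum_nonneg fun _ _ => sq_nonneg _
    have hAle : 1024 * A ≤ ‖p‖ ^ 2 := by
      have h1 : (Δ / 2) ^ 2 * A ≤ (ε * ‖p‖) ^ 2 := by
        calc (Δ / 2) ^ 2 * A ≤ (Δ - ε) ^ 2 * A := by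
              have : Δ / 2 ≤ Δ - ε := by linarith
              gcongr
          _ ≤ _ := hcompl
          _ ≤ _ := by gcongr
      refine le_of_mul_le_mul_left ?_ (pow_pos hΔ 2)
      have h2 : 1024 * (2 * ε) ^ 2 * ‖p‖ ^ 2 ≤ 1 * Δ ^ 2 * ‖p‖ ^ 2 := by
        have : 1024 * (2 * ε) ^ 2 ≤ 1 * Δ ^ 2 := hs2.trans (by gcongr)
        gcongr
      linarith
    have hBle : 1024 * ∑ k ∈ T, ⟪b k, q⟫_ℝ ^ 2 ≤ 2 * D := by
      have h1 := hperp q (Nᗮ.starProjection_apply_mem _)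
      refine le_of_mul_le_mul_left ?_ (pow_pos hΔ 2)
      have h2 : (2 * ε) ^ 2 * ‖q‖ ^ 2 ≤ (2 * ε) ^ 2 * 2 := by gcongr
      linarith
    have hlow' : D / 2 < ∑ k ∈ T, ⟪b k, edgeVec e⟫_ℝ ^ 2 := by linarith
    have h3 := hlow e
    have h4 := mul_lt_mul_of_pos_left hlow' hpos
    have h5 : a₁ * τ / (4 * maxCompSize βstar) = a₁ * τ * (D / 2) / 2 := by
      rw [hD]; field_simp; norm_num
    linarith
  · -- Either term of the minimum bounds the sum of `‖E (b k)‖ ^ 2` over `T`; for the second one,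
    -- `T` has at most as many elements as there are components.
    set η := residFrob βstar (absVec x - absVec βstar) with hη
    have hη0 : 0 ≤ η := le_min (Real.sqrt_nonneg _) (mul_nonneg (Real.sqrt_nonneg _) hε0)
    have hEb : ∀ k, lapOp (absVec x) (b k) - lapOp (absVec βstar) (b k)
        = Matrix.toEuclideanCLM (𝕜 := ℝ) E (b k) := fun k => by
      change _ = lapOp (absVec x - absVec βstar) (b k)
      rw [lapOp_sub]
      rfl
    have hsumE : ∑ k ∈ T, ‖Matrix.toEuclideanCLM (𝕜 := ℝ) E (b k)‖ ^ 2 ≤ η ^ 2 := by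
      rcases min_choice (frobNorm E) (Real.sqrt (numComp βstar) * opNorm E) with h | h
      · have h' : η = frobNorm E := h
        rw [h', ← sum_norm_sq_toEuclideanCLM E b]
        exact Finset.sum_le_univ_sum_of_nonneg fun _ => sq_nonneg _
      · have h' : η = Real.sqrt (numComp βstar) * ε := h
        rw [h', mul_pow, Real.sq_sqrt (Nat.cast_nonneg _)]
        have hcard : (T.card : ℝ) ≤ numComp βstar := by
          rw [← finrank_compConst]
          exact_mod_cast hpert.card_le_finrank b T heig hsmall
        calc ∑ k ∈ T, ‖Matrix.toEuclideanCLM (𝕜 := ℝ) E (b k)‖ ^ 2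
            ≤ ∑ _k ∈ T, ε ^ 2 := by
              refine Finset.sum_le_sum fun k _ => ?_
              have h1 := norm_lapOp_le (absVec x - absVec βstar) (b k)
              rw [b.orthonormal.1 k, mul_one] at h1
              exact pow_le_pow_left₀ (norm_nonneg _) h1 2
          _ = T.card * ε ^ 2 := by rw [Finset.sum_const, nsmul_eq_mul]
          _ ≤ _ := by gcongr
    have hQ : ∑ k ∈ T, ‖Nᗮ.starProjection (b k)‖ ^ 2 ≤ 4 * ρ ^ 2 := by
      have h1 : (Δ / 2) ^ 2 * ∑ k ∈ T, ‖Nᗮ.starProjection (b k)‖ ^ 2 ≤ η ^ 2 := by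
        refine le_trans ?_ hsumE
        rw [Finset.mul_sum]
        refine Finset.sum_le_sum fun k hk => ?_
        rw [← mul_pow, ← hEb]
        refine pow_le_pow_left₀ (by positivity) (le_trans ?_
          (hpert.norm_orthogonal_le (heig k) (hsmall k hk))) 2
        have : Δ / 2 ≤ Δ - ε := by linarith
        gcongr
      have h2 : η ^ 2 ≤ (ρ * Δ) ^ 2 := by gcongr
      refine le_of_mul_le_mul_left ?_ (pow_pos hΔ 2)
      linarith
    have hedge : ∀ k, ∀ e ∈ blockSupport βstar, ⟪b k, edgeVec e⟫_ℝ ^ 2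
        = (Nᗮ.starProjection (b k) e.1.1 - Nᗮ.starProjection (b k) e.1.2) ^ 2 := fun k e he => by
      rw [← inner_edgeVec, Submodule.inner_starProjection_left_eq_right,
        Submodule.starProjection_eq_self_iff.2 (edgeVec_mem_orthogonal he)]
    calc ∑ e ∈ blockSupport βstar, lapCoeff V (fun k => penaltyDeriv g (ev k)) e
        ≤ ∑ e ∈ blockSupport βstar, a₀ * τ * ∑ k ∈ T, ⟪b k, edgeVec e⟫_ℝ ^ 2 :=
          Finset.sum_le_sum fun e _ => hup e
      _ = a₀ * τ * ∑ k ∈ T, ∑ e ∈ blockSupport βstar, ⟪b k, edgeVec e⟫_ℝ ^ 2 := by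
          rw [← Finset.mul_sum, Finset.sum_comm]
      _ ≤ a₀ * τ * ∑ k ∈ T, 2 * maxCompSize βstar * ‖Nᗮ.starProjection (b k)‖ ^ 2 := by
          refine mul_le_mul_of_nonneg_left (Finset.sum_le_sum fun k _ => ?_) hpos₀.le
          rw [Finset.sum_congr rfl (hedge k)]
          exact sum_sq_sub_le βstar _
      _ ≤ a₀ * τ * (2 * maxCompSize βstar * (4 * ρ ^ 2)) := by
          rw [← Finset.mul_sum]
          gcongr
      _ = _ := by ring

end Weights

/-! ### Convergence of the algorithm on the good event -/

section Convergence

variable {d : ℕ} {βstar : ParamSpace d} {a₀ a₁ b₁ b₂ τ ρ : ℝ} {g : ℝ → ℝ}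

theorem isLassoOracle_zero_iff {loss : ParamSpace d → ℝ} {S : Finset (Edge d)} {β : ParamSpace d} :
    IsLassoOracle loss S (fun _ => 0) β ↔ IsBlockOracle loss S β := by
  simp [IsLassoOracle, IsBlockOracle]

/-- From a vector that is close to the target and supported on its blocks, a step of the algorithm
returns the block oracle: its weights vanish inside the blocks, and between the blocks they
dominate the gradient at the oracle. -/
theorem isLLAStep_iff_eq_oracle (hg : IsScadLike a₀ a₁ b₁ b₂ τ g) (hτ : 0 < τ)
    (hgap : (((b₁ + b₂) * τ : ℝ) : EReal) ≤ spectralGap βstar) (hmax : 0 < maxCompSize βstar)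
    {loss : ParamSpace d → ℝ} (hconv : ConvexOn ℝ univ loss) (hdiff : Differentiable ℝ loss)
    {b : ParamSpace d} (hb : IsBlockOracle loss (blockSupport βstar) b)
    (huniq : ∀ β, IsBlockOracle loss (blockSupport βstar) β → β = b)
    (hgrad : ∀ e, e ∉ blockSupport βstar →
      |gradient loss b e| ≤ a₁ * τ / (4 * maxCompSize βstar))
    {x : ParamSpace d} (hx : opNorm (lap (absVec x - absVec βstar)) < b₁ * τ)
    (hS : x ∈ supportedOn (blockSupport βstar)) (β : ParamSpace d) :
    IsLLAStep loss g x β ↔ β = b := by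
  have hstep : ∀ V ∈ Matrix.orthogonalGroup (Fin d) ℝ, ∀ ev : Fin d → ℝ,
      lap (absVec x) * V = V * Matrix.diagonal ev →
      (IsMinOn (fun x : ParamSpace d => loss x
        + 1 / 2 * ∑ e, |x e| * lapCoeff V (fun k => penaltyDeriv g (ev k)) e) univ β ↔ β = b) := by
    intro V hV ev hev
    obtain ⟨hin, hout⟩ := lapCoeff_of_mem_supportedOn hg hτ hgap hx hS hmax hV hev
    exact isMinOn_penalized_iff hconv hdiff (w := fun _ => 0) (fun _ => le_rfl)
      (fun e he => (hin e he).symm) (isLassoOracle_zero_iff.2 hb)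
      (fun β hβ => huniq β (isLassoOracle_zero_iff.1 hβ))
      (fun e he => (hgrad e he).trans_lt (hout e he)) β
  constructor
  · rintro ⟨V, hV, ev, hev, hmin⟩
    exact (hstep V hV ev hev).1 hmin
  · intro h
    obtain ⟨V, hV, ev, hev⟩ := exists_orthogonal_diagonalization (absVec x)
    exact ⟨V, hV, ev, hev, (hstep V hV ev hev).2 h⟩

/-- The deterministic part of the argument.  `B` is a set that contains all Lasso oracles whose
weights are as small as those of the first step; the zero weights, which belong to the block
oracle, are among these. -/
theorem llaConvergesInTwoSteps_of_close (hg : IsScadLike a₀ a₁ b₁ b₂ τ g) (hτ : 0 < τ)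
    (hgap : (((b₁ + b₂) * τ : ℝ) : EReal) ≤ spectralGap βstar) (hmax : 0 < maxCompSize βstar)
    {loss : ParamSpace d → ℝ} (hconv : ConvexOn ℝ univ loss) (hdiff : Differentiable ℝ loss)
    {b : ParamSpace d} (hb : IsBlockOracle loss (blockSupport βstar) b)
    (huniq : ∀ β, IsBlockOracle loss (blockSupport βstar) β → β = b)
    (hlasso : ∀ w : Edge d → ℝ, IsLassoWeight (blockSupport βstar) w →
      ∃! β, IsLassoOracle loss (blockSupport βstar) w β)
    {x : ParamSpace d} (hx : opNorm (lap (absVec x - absVec βstar)) < b₁ * τ)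
    (hxρ : opNorm (lap (absVec x - absVec βstar)) ≤ ρ * ((b₁ + b₂) * τ))
    (hxs : opNorm (lap (absVec x - absVec βstar))
      ≤ 1 / 2 ^ 6 * Real.sqrt (a₁ / (a₀ * maxCompSize βstar)) * ((b₁ + b₂) * τ))
    {B : Set (ParamSpace d)}
    (hB : ∀ w : Edge d → ℝ, IsLassoWeight (blockSupport βstar) w →
      (∀ e, w e ≤ 8 * a₀ * τ * ρ ^ 2) →
      (residFrob βstar (absVec x - absVec βstar) ≤ ρ * ((b₁ + b₂) * τ) →
        ∑ e, w e ≤ 8 * maxCompSize βstar * a₀ * τ * ρ ^ 2) →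
      ∀ β, IsLassoOracle loss (blockSupport βstar) w β → β ∈ B)
    (hgrad : ∀ β ∈ B, ∀ e, e ∉ blockSupport βstar →
      |gradient loss β e| ≤ a₁ * τ / (4 * maxCompSize βstar))
    (hres : ∀ β ∈ B, opNorm (lap (absVec β - absVec βstar)) < b₁ * τ) :
    LLAConvergesInTwoSteps loss g x b := by
  classical
  have ha₀ := hg.a₀_pos
  have hbB : b ∈ B := by
    refine hB (fun _ => 0) ⟨fun _ => le_rfl, fun _ _ => rfl⟩ (fun _ => by positivity)
      (fun _ => ?_) b (isLassoOracle_zero_iff.2 hb)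
    rw [Finset.sum_const_zero]
    positivity
  have hfirst : ∀ V ∈ Matrix.orthogonalGroup (Fin d) ℝ, ∀ ev : Fin d → ℝ,
      lap (absVec x) * V = V * Matrix.diagonal ev →
      ∃ β₁, β₁ ∈ B ∧ β₁ ∈ supportedOn (blockSupport βstar) ∧ ∀ β,
        IsMinOn (fun x : ParamSpace d => loss x
          + 1 / 2 * ∑ e, |x e| * lapCoeff V (fun k => penaltyDeriv g (ev k)) e) univ β
          ↔ β = β₁ := by
    intro V hV ev hev
    obtain ⟨hnonneg, hin, hout, hsum⟩ :=
      lapCoeff_of_close hg hτ hgap hx hxρ hxs hmax hV hev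
    set m := lapCoeff V (fun k => penaltyDeriv g (ev k)) with hm
    let w : Edge d → ℝ := fun e => if e ∈ blockSupport βstar then m e else 0
    have hw : IsLassoWeight (blockSupport βstar) w :=
      ⟨fun e => by dsimp only [w]; split_ifs; exacts [hnonneg e, le_rfl],
        fun e he => if_neg he⟩
    obtain ⟨β₁, hβ₁, hβ₁u⟩ := hlasso w hw
    have hmem : β₁ ∈ B := by
      refine hB w hw (fun e => ?_) (fun h => ?_) β₁ hβ₁
      · dsimp only [w]
        split_ifs with he
        · exact hin e he
        · positivity
      · dsimp only [w]
        rw [Finset.sum_ite_mem, Finset.univ_inter]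
        exact hsum h
    exact ⟨β₁, hmem, hβ₁.1, fun β => isMinOn_penalized_iff hconv hdiff hw.1
      (fun e he => if_pos he) hβ₁ hβ₁u
      (fun e he => (hgrad β₁ hmem e he).trans_lt (hout e he)) β⟩
  have hsecond : ∀ β₁ ∈ B, β₁ ∈ supportedOn (blockSupport βstar) → ∀ β,
      (IsLLAStep loss g β₁ β ↔ β = b) := fun β₁ h₁ hS β =>
    isLLAStep_iff_eq_oracle hg hτ hgap hmax hconv hdiff hb huniq (hgrad b hbB) (hres β₁ h₁) hS β
  refine ⟨?_, ?_, hsecond b hbB hb.1⟩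
  · obtain ⟨V, hV, ev, hev⟩ := exists_orthogonal_diagonalization (absVec x)
    obtain ⟨β₁, -, -, h⟩ := hfirst V hV ev hev
    exact ⟨β₁, V, hV, ev, hev, (h β₁).2 rfl⟩
  · rintro β₁ ⟨V, hV, ev, hev, hmin⟩
    obtain ⟨β₁', hB', hS', h⟩ := hfirst V hV ev hev
    obtain rfl := (h β₁).1 hmin
    exact ⟨⟨b, (hsecond β₁ hB' hS' b).2 rfl⟩, fun β₂ h₂ => (hsecond β₁ hB' hS' β₂).1 h₂⟩

end Convergence

/-! ### The probability of the good event -/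

section Probability

variable {d : ℕ} {βstar : ParamSpace d} {a₀ a₁ b₁ b₂ τ ρ : ℝ}

/-- Union bound; the bad events need not be measurable. -/
theorem holdsWithProbAtLeast_of_ae {Ω : Type*} [MeasurableSpace Ω] {μ : Measure Ω}
    [IsProbabilityMeasure μ] {A₁ A₂ A₃ G : Set Ω}
    (h : ∀ᵐ ω ∂μ, ω ∉ A₁ → ω ∉ A₂ → ω ∉ A₃ → ω ∈ G) :
    HoldsWithProbAtLeast μ (1 - μ.real A₁ - μ.real A₂ - μ.real A₃) G := by
  set Z : Set Ω := {ω | ¬ (ω ∉ A₁ → ω ∉ A₂ → ω ∉ A₃ → ω ∈ G)} with hZ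
  have hZ0 : μ.real Z = 0 := by
    rw [measureReal_def, (ae_iff.1 h : μ Z = 0), ENNReal.toReal_zero]
  set A := A₁ ∪ A₂ ∪ A₃ ∪ Z with hA
  refine ⟨(toMeasurable μ A)ᶜ, (measurableSet_toMeasurable μ A).compl, fun ω hω => ?_, ?_⟩
  · have hnot : ω ∉ A := fun hmem => hω (subset_toMeasurable μ A hmem)
    simp only [hA, mem_union, not_or] at hnot
    obtain ⟨⟨⟨h1, h2⟩, h3⟩, h4⟩ := hnot
    exact not_not.1 h4 h1 h2 h3
  · rw [probReal_compl_eq_one_sub (measurableSet_toMeasurable μ A),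
      measureReal_def (s := toMeasurable μ A), measure_toMeasurable, ← measureReal_def]
    have e1 := measureReal_union_le (μ := μ) (A₁ ∪ A₂ ∪ A₃) Z
    have e2 := measureReal_union_le (μ := μ) (A₁ ∪ A₂) A₃
    have e3 := measureReal_union_le (μ := μ) A₁ A₂
    linarith

/-- What a good initializer satisfies.  The strict inequality with a nonnegative left hand side
forces `τ` and all three terms of the minimum in the constant to be positive. -/
theorem bounds_of_lt_initConst {r : ℝ} (hr : 0 ≤ r) (hτ : 0 ≤ τ) (hb₁ : 0 < b₁) (hb : b₁ < b₂)
    (h : r < initConst βstar a₀ a₁ b₁ b₂ ρ * τ) :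
    0 < τ ∧ 0 < maxCompSize βstar ∧ r < b₁ * τ ∧ r ≤ ρ * ((b₁ + b₂) * τ) ∧
      r ≤ 1 / 2 ^ 6 * Real.sqrt (a₁ / (a₀ * maxCompSize βstar)) * ((b₁ + b₂) * τ) := by
  have hbb : 0 < b₁ + b₂ := by linarith
  rw [initConst, mul_assoc] at h
  set s := 1 / 2 ^ 6 * Real.sqrt (a₁ / (a₀ * maxCompSize βstar)) with hs
  set c := min (min ρ s) (b₁ / (b₁ + b₂)) with hc
  have hΔ : 0 ≤ (b₁ + b₂) * τ := by positivity
  have hcΔ := hr.trans_lt h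
  have hτ' : 0 < τ := hτ.lt_of_ne fun h0 => by simp [← h0] at hcΔ
  have hc0 : 0 < c := pos_of_mul_pos_left hcΔ hΔ
  have hcρ : c ≤ ρ := (min_le_left _ _).trans (min_le_left _ _)
  have hcs : c ≤ s := (min_le_left _ _).trans (min_le_right _ _)
  have hcb : c * (b₁ + b₂) ≤ b₁ := (le_div_iff₀ hbb).1 (min_le_right _ _)
  refine ⟨hτ', Nat.pos_of_ne_zero fun h0 => ?_, ?_, h.le.trans (by gcongr),
    h.le.trans (by gcongr)⟩
  · have hs0 := hc0.trans_le hcs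
    rw [hs, h0] at hs0
    simp at hs0
  · refine h.trans_le ?_
    rw [← mul_assoc]
    gcongr

/-- The hypothesis excludes `d = 0`, so there is at least one component. -/
theorem opNorm_le_residFrob (hmax : 0 < maxCompSize βstar) (r : ParamSpace d) :
    opNorm (lap r) ≤ residFrob βstar r := by
  refine le_min (opNorm_le_frobNorm _) ?_
  have hK : (1 : ℝ) ≤ Real.sqrt (numComp βstar) := by
    rw [Real.one_le_sqrt, Nat.one_le_cast, Nat.one_le_iff_ne_zero, numComp, Nat.card_ne_zero]
    refine ⟨?_, inferInstance⟩
    by_contra hempty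
    rw [not_nonempty_iff] at hempty
    simp [maxCompSize] at hmax
  exact le_mul_of_one_le_left (norm_nonneg _) hK

theorem norm_le_of_isLassoWeight {S : Finset (Edge d)} {w : Edge d → ℝ} (hw : IsLassoWeight S w)
    {c : ℝ} (hc : 0 ≤ c) (h : ∀ e, w e ≤ 8 * c) : ‖w‖ ≤ 2 ^ 5 * c := by
  refine (pi_norm_le_iff_of_nonneg (by positivity)).2 fun e => ?_
  rw [Real.norm_eq_abs, abs_of_nonneg (hw.1 e)]
  linarith [h e]

/-- The Euclidean norm of the weights is controlled by interpolation between the maximum and the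
sum of the weights. -/
theorem sqrt_sum_sq_le_of_isLassoWeight {S : Finset (Edge d)} {w : Edge d → ℝ}
    (hw : IsLassoWeight S w) {c n : ℝ} (hc : 0 ≤ c) (hn : 0 ≤ n) (h : ∀ e, w e ≤ 8 * c)
    (hsum : ∑ e, w e ≤ 8 * n * c) :
    Real.sqrt (∑ e, w e ^ 2) ≤ (2 : ℝ) ^ (9 / 2 : ℝ) * Real.sqrt n * c := by
  have h8 : (8 : ℝ) ≤ (2 : ℝ) ^ (9 / 2 : ℝ) := by
    calc (8 : ℝ) = (2 : ℝ) ^ (3 : ℝ) := by norm_num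
      _ ≤ _ := Real.rpow_le_rpow_of_exponent_le (by norm_num) (by norm_num)
  have hle : ∑ e, w e ^ 2 ≤ 8 * c * (8 * n * c) := by
    calc ∑ e, w e ^ 2 ≤ ∑ e, 8 * c * w e :=
          Finset.sum_le_sum fun e _ => by nlinarith [h e, hw.1 e]
      _ = 8 * c * ∑ e, w e := by rw [Finset.mul_sum]
      _ ≤ _ := by gcongr
  calc Real.sqrt (∑ e, w e ^ 2) ≤ 8 * Real.sqrt n * c := by
        refine Real.sqrt_le_iff.2 ⟨by positivity, ?_⟩
        rw [mul_pow, mul_pow, Real.sq_sqrt hn]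
        linarith
    _ ≤ _ := by gcongr

theorem abs_gradient_le_of_iSup_le {f : ParamSpace d → ℝ} {S : Finset (Edge d)}
    {B : Set (ParamSpace d)} {c : ℝ} (hc : 0 ≤ c)
    (h : ¬ ENNReal.ofReal c < ⨆ β ∈ B, ⨆ (e : Edge d) (_ : e ∉ S),
      ENNReal.ofReal |gradient f β e|) :
    ∀ β ∈ B, ∀ e, e ∉ S → |gradient f β e| ≤ c := by
  intro β hβ e he
  simp only [not_lt, iSup_le_iff] at h
  exact (ENNReal.ofReal_le_ofReal_iff hc).1 (h β hβ e he)

theorem lt_of_not_le_iSup_ofReal {α : Type*} {f : α → ℝ} {B : Set α} (hf : ∀ x, 0 ≤ f x) {c : ℝ}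
    (h : ¬ ENNReal.ofReal c ≤ ⨆ x ∈ B, ENNReal.ofReal (f x)) : ∀ x ∈ B, f x < c := by
  intro x hx
  rw [not_le] at h
  exact (ENNReal.ofReal_lt_ofReal_iff_of_nonneg (hf x)).1
    ((le_iSup₂ (f := fun x (_ : x ∈ B) => ENNReal.ofReal (f x)) x hx).trans_lt h)

end Probability

theorem mainTheorem4 {Ω : Type*} [MeasurableSpace Ω] (μ : Measure Ω) [IsProbabilityMeasure μ]
    (d : ℕ) (βstar : ParamSpace d)
    (a₀ a₁ b₁ b₂ τ ρ : ℝ) (hτ : 0 ≤ τ) (hρ : 0 ≤ ρ)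
    (g : ℝ → ℝ) (hg : IsScadLike a₀ a₁ b₁ b₂ τ g)
    (loss : Ω → ParamSpace d → ℝ) (βinit βoracle : Ω → ParamSpace d)
    (hconv : ∀ᵐ ω ∂μ, ConvexOn ℝ univ (loss ω))
    (hdiff : ∀ᵐ ω ∂μ, Differentiable ℝ (loss ω))
    (horacle : ∀ᵐ ω ∂μ, IsBlockOracle (loss ω) (blockSupport βstar) (βoracle ω) ∧
      ∀ β, IsBlockOracle (loss ω) (blockSupport βstar) β → β = βoracle ω)
    (hlasso : ∀ᵐ ω ∂μ, ∀ w : Edge d → ℝ, IsLassoWeight (blockSupport βstar) w →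
      ∃! β, IsLassoOracle (loss ω) (blockSupport βstar) w β)
    (hgap : (((b₁ + b₂) * τ : ℝ) : EReal) ≤ spectralGap βstar) :
    HoldsWithProbAtLeast μ
      (1 - probGoodInit μ residOp βinit βstar a₀ a₁ b₁ b₂ ρ τ
        - probNiceGrad μ loss (fun ω => lassoOracleSetOp (loss ω) βstar a₀ ρ τ) βstar a₁ τ
        - probSmallLapResid μ (fun ω => lassoOracleSetOp (loss ω) βstar a₀ ρ τ) βstar b₁ τ)
      {ω | LLAConvergesInTwoSteps (loss ω) g (βinit ω) (βoracle ω)} ∧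
    HoldsWithProbAtLeast μ
      (1 - probGoodInit μ (residFrob βstar) βinit βstar a₀ a₁ b₁ b₂ ρ τ
        - probNiceGrad μ loss (fun ω => lassoOracleSetFrob (loss ω) βstar a₀ ρ τ) βstar a₁ τ
        - probSmallLapResid μ (fun ω => lassoOracleSetFrob (loss ω) βstar a₀ ρ τ) βstar b₁ τ)
      {ω | LLAConvergesInTwoSteps (loss ω) g (βinit ω) (βoracle ω)} := by
  have hgrad0 : 0 ≤ a₁ * τ / (4 * maxCompSize βstar) := by
    have := hg.a₁_pos
    positivity
  have hc : 0 ≤ a₀ * τ * ρ ^ 2 := by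
    have := hg.a₀_pos
    positivity
  constructor
  · refine holdsWithProbAtLeast_of_ae ?_
    filter_upwards [hconv, hdiff, horacle, hlasso] with ω h₁ h₂ h₃ h₄ hinit hgrad hres
    obtain ⟨hτ', hmax, hx, hxρ, hxs⟩ := bounds_of_lt_initConst (norm_nonneg _) hτ hg.b₁_pos
      hg.b₁_lt_b₂ (not_le.1 hinit)
    refine llaConvergesInTwoSteps_of_close hg hτ' hgap hmax h₁ h₂ h₃.1 h₃.2 h₄ hx hxρ hxs
      (B := lassoOracleSetOp (loss ω) βstar a₀ ρ τ)
      (fun w hw hw₁ _ β hβ => ⟨w, hw, ?_, hβ⟩) (abs_gradient_le_of_iSup_le hgrad0 hgrad)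
      (lt_of_not_le_iSup_ofReal (fun _ => norm_nonneg _) hres)
    have h := norm_le_of_isLassoWeight hw hc fun e => (hw₁ e).trans_eq (by ring)
    exact h.trans_eq (by ring)
  · refine holdsWithProbAtLeast_of_ae ?_
    filter_upwards [hconv, hdiff, horacle, hlasso] with ω h₁ h₂ h₃ h₄ hinit hgrad hres
    have hr : 0 ≤ residFrob βstar (absVec (βinit ω) - absVec βstar) :=
      le_min (Real.sqrt_nonneg _) (mul_nonneg (Real.sqrt_nonneg _) (norm_nonneg _))
    obtain ⟨hτ', hmax, hx, hxρ, hxs⟩ := bounds_of_lt_initConst hr hτ hg.b₁_pos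
      hg.b₁_lt_b₂ (not_le.1 hinit)
    have hop := opNorm_le_residFrob hmax (absVec (βinit ω) - absVec βstar)
    refine llaConvergesInTwoSteps_of_close hg hτ' hgap hmax h₁ h₂ h₃.1 h₃.2 h₄
      (hop.trans_lt hx) (hop.trans hxρ) (hop.trans hxs)
      (B := lassoOracleSetFrob (loss ω) βstar a₀ ρ τ)
      (fun w hw hw₁ hw₂ β hβ => ⟨w, hw, ?_, ?_, ?_, hβ⟩)
      (abs_gradient_le_of_iSup_le hgrad0 hgrad)
      (lt_of_not_le_iSup_ofReal (fun _ => norm_nonneg _) hres)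
    · have h := norm_le_of_isLassoWeight hw hc fun e => (hw₁ e).trans_eq (by ring)
      exact h.trans_eq (by ring)
    · have h := sqrt_sum_sq_le_of_isLassoWeight hw hc (Nat.cast_nonneg (maxCompSize βstar))
        (fun e => (hw₁ e).trans_eq (by ring)) ((hw₂ hxρ).trans_eq (by ring))
      exact h.trans_eq (by ring)
    · rw [Finset.sum_congr rfl fun e _ => abs_of_nonneg (hw.1 e)]
      have h0 : 0 ≤ (maxCompSize βstar : ℝ) * (a₀ * τ * ρ ^ 2) := by positivity
      linarith [hw₂ hxρ]
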